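/- Let $m\ge 1$ be an integer and let $\mathrm{Pol}=\mathbb Z[x_1,x_2,\dots]$. **Operators.** For $i\ge 1$ put $R_i f=f(x_1,\dots,x_{i-1},0,x_i,x_{i+1},\dots)$ and let $R_{i}^{\infty}f=f(x_1,\dots,x_{i-1},0,0,\dots)$ (the limit of $R_i^n f$ as $n\to\infty$). Let $$T^{(m)}_i=\frac{R_{i+1}^m-R_i^m}{x_i},\qquad D^{(m)}_i=R_{i+1}^{\infty}\,T^{(m)}_i .$$ The $m$-slide creator $B^{(m)}_a$ ($a\ge1$) is the linear endomorphism of $\mathrm{Pol}$ that vanishes on monomials not in $\mathbb Z[x_1,\dots,x_a]$ and satisfies $$B^{(m)}_a(x_1^{p_1}\cdots x_j^{p_j}x_a^p)=x_1^{p_1}\cdots x_j^{p_j}\sum_{r\ge 0,\ a-rm>j}x_{a-rm}^{p+1}$$ whenever $0\le j<a$, $p\ge 0$, and $p_j>0$ or $j=0$. Operators $Y_i$ ($i\ge1$) are called creation operators for operators $Z_i$ if each $Y_i$ maps homogeneous polynomials of degree $d$ to homogeneous polynomials of degree $d+1$ and $\sum_{i\ge1}Y_iZ_i=\mathrm{id}$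 on the polynomials without constant term, where the sum applied to any such polynomial has only finitely many nonzero terms. **Slides.** For a sequence $a=(a_1,\dots,a_k)$ of positive integers, $k\ge 0$, the $m$-slide polynomial is $\mathfrak F^{(m)}_a=\sum x_{i_1}\cdots x_{i_k}$, the sum being over all sequences of positive integers $i_1\le\cdots\le i_k$ with $i_j\equiv a_j \pmod m$ and $i_j\le a_j$ for all $j$, and $i_j<i_{j+1}$ whenever $a_j<a_{j+1}$. **Forests.** An indexed $(m+1)$-ary forest is a sequence $F=(T_1,T_2,\dots)$ of rooted plane $(m+1)$-ary trees, all but finitely many of which consist of a single leaf; its leaves are numbered $1,2,\dots$ from left to right, and $\varnothing$ is the forest all of whose trees are single leaves. The product $F\cdot G$ is obtained by identifying the $i$-th leaf of $F$ with the $i$-th root of $G$ for all $i$. Let $\underline i$ be the forest with exactly one internal node, whose leftmost child is the leaf $i$. If $F=G\cdot\underline i$, then we write $G=F/i$ (it is obtained from $F$ by deleting a terminal node with leftmost leaf $i$); otherwise $F/i$ is undefined. Let $\mathrm{Trim}(F)$ be the set of sequences $(i_1,\dots,i_k)$, $k\geq 0$, with $(((F/i_k)/i_{k-1})/\cdots)/i_1=\varnothing$,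 i.e. $F=\underline{i_1}\cdots\underline{i_k}$. **Theorem.** 1. For every sequence $a=(a_1,\dots,a_k)$ of positive integers and every $p\ge 1$ we have $B^{(m)}_p\,\mathfrak F^{(m)}_{a}=\mathfrak F^{(m)}_{a_1,\dots,a_k,p}$. In particular $\mathfrak F^{(m)}_{b_1,\dots,b_k}=B^{(m)}_{b_k}\cdots B^{(m)}_{b_1}(1)$ for every sequence $(b_1,\dots,b_k)$ of positive integers. 2. On polynomials without constant term $\sum_{i\ge1}B^{(m)}_iD^{(m)}_i=\sum_{i\ge1}B^{(m)}_iT^{(m)}_i=\mathrm{id}$; more precisely, the $B^{(m)}_i$ are creation operators for the $D^{(m)}_i$ and for the $T^{(m)}_i$. In particular, there is a unique family of homogeneous polynomials $P^{(m)}_F$, indexed by the indexed $(m+1)$-ary forests $F$ (the $m$-forest polynomials), such that $P^{(m)}_\varnothing=1$ and, for all $F$ and all $i\ge 1$, $T^{(m)}_iP^{(m)}_F=P^{(m)}_{F/i}$ if $F/i$ is defined and $T^{(m)}_iP^{(m)}_F=0$ otherwise; moreover $\mathrm{Trim}(F)$ is finite and $$P^{(m)}_F=\sum_{(i_1,\dots,i_k)\in\mathrm{Trim}(F)}\mathfrak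 F^{(m)}_{i_1,\dots,i_k}\qquad\text{for every }F.$$ -/

import Mathlib

namespace MSlides

open MvPolynomial

/-- The polynomial ring `ℤ[x₁, x₂, …]`; the variables are indexed by the positive integers. -/
abbrev Pol : Type := MvPolynomial ℕ+ ℤ

/-! ### The operators -/

/-- The Bergeron–Sottile map `R_i f = f(x₁, …, x_{i-1}, 0, x_i, x_{i+1}, …)`. -/
noncomputable def rope (i : ℕ+) : Pol →ₐ[ℤ] Pol :=
  aeval fun j : ℕ+ => if j < i then X j else if j = i then 0 else X (j - 1)

/-- The truncation `R_i^∞ f = f(x₁, …, x_{i-1}, 0, 0, …)`, the pointwise limit of the powers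
of `R_i`. -/
noncomputable def trunc (i : ℕ+) : Pol →ₐ[ℤ] Pol :=
  aeval fun j : ℕ+ => if j < i then X j else 0

/-- The `m`-quasisymmetric divided difference `T_i^{(m)} = (R_{i+1}^m - R_i^m) / x_i`.
The division is exact, see `X_mul_tope`. -/
noncomputable def tope (m : ℕ) (i : ℕ+) : Module.End ℤ Pol where
  toFun f := ((rope (i + 1) ^ m) f - (rope i ^ m) f).divMonomial (Finsupp.single i 1)
  map_add' f g := by
    rw [← add_divMonomial]
    congr 1
    simp only [map_add]
    ring
  map_smul' c f := by
    rw [map_zsmul, map_zsmul, ← smul_sub]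
    ext s
    simp only [coeff_divMonomial, coeff_smul, RingHom.id_apply]

/-- The `m`-slide extractor `D_i^{(m)} = R_{i+1}^∞ T_i^{(m)}`. -/
noncomputable def dope (m : ℕ) (i : ℕ+) : Module.End ℤ Pol :=
  (trunc (i + 1)).toLinearMap ∘ₗ tope m i

/-- The value of the `m`-slide creator `B_a^{(m)}` on the monomial `x^d`.
It is zero unless `x^d` only involves `x₁, …, x_a`. In that case write
`x^d = x₁^{p₁} ⋯ x_j^{p_j} x_a^p` with `j < a` and `p_j > 0` or `j = 0`;
the value is `x₁^{p₁} ⋯ x_j^{p_j} ∑ x_k^{p+1}`, the sum being over `j < k ≤ a`, `k ≡ a mod m`. -/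
noncomputable def builderMonomial (m : ℕ) (a : ℕ+) (d : ℕ+ →₀ ℕ) : Pol :=
  if ∀ l ∈ d.support, l ≤ a then
    monomial (d.erase a) 1 *
      ∑ k ∈ (Finset.Icc 1 a).filter
        (fun k : ℕ+ => (k : ℕ) ≡ (a : ℕ) [MOD m] ∧ ∀ l ∈ (d.erase a).support, l < k),
        X k ^ (d a + 1)
  else 0

/-- The `m`-slide creator `B_a^{(m)}`, extended linearly from monomials. -/
noncomputable def builder (m : ℕ) (a : ℕ+) : Module.End ℤ Pol :=
  (basisMonomials ℕ+ ℤ).constr ℤ (builderMonomial m a)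

/-- The operators `Y_i` are creation operators for the operators `Z_i`: each `Y_i` raises degrees
by one, and `∑ Y_i Z_i = id` on polynomials without constant term, where for each such polynomial
all but finitely many terms of the sum vanish. -/
def IsCreationFor (Y Z : ℕ+ → Module.End ℤ Pol) : Prop :=
  (∀ (i : ℕ+) (f : Pol) (d : ℕ), f.IsHomogeneous d → (Y i f).IsHomogeneous (d + 1)) ∧
  ∀ f : Pol, constantCoeff f = 0 →
    (Function.support fun i => Y i (Z i f)).Finite ∧ ∑ᶠ i, Y i (Z i f) = f

/-! ### Slide polynomials -/

/-- The `m`-compatible sequences of `a = (a₁, …, a_k)`: the weakly increasing sequences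
`i₁ ≤ ⋯ ≤ i_k` of positive integers with `i_j ≡ a_j mod m`, `i_j ≤ a_j`, and `i_j < i_{j+1}`
whenever `a_j < a_{j+1}`. -/
def compatible (m : ℕ) {k : ℕ} (a : Fin k → ℕ+) : Set (Fin k → ℕ+) :=
  {i | Monotone i ∧ (∀ j, (i j : ℕ) ≡ (a j : ℕ) [MOD m]) ∧ (∀ j, i j ≤ a j) ∧
    ∀ j j' : Fin k, (j' : ℕ) = j + 1 → a j < a j' → i j < i j'}

theorem compatible_finite (m : ℕ) {k : ℕ} (a : Fin k → ℕ+) : (compatible m a).Finite :=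
  (Set.finite_Iic a).subset fun _ hi j => hi.2.2.1 j

/-- The `m`-slide polynomial: the generating function of the `m`-compatible sequences. -/
noncomputable def slide (m : ℕ) {k : ℕ} (a : Fin k → ℕ+) : Pol :=
  ∑ i ∈ (compatible_finite m a).toFinset, ∏ j, X (i j)

/-! ### Indexed forests -/

/-- Rooted plane `(m+1)`-ary trees: a node is a leaf or has `m + 1` ordered children. -/
inductive Tree (m : ℕ) : Type
  | leaf : Tree m
  | node : (Fin (m + 1) → Tree m) → Tree m

/-- The number of leaves of a tree. -/
def Tree.leaves {m : ℕ} : Tree m → ℕ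
  | .leaf => 1
  | .node c => ∑ j, (c j).leaves

/-- The tree obtained from `t` by identifying its leaves, numbered `0, 1, 2, …` from left to right,
with the roots of `G 0, G 1, G 2, …`. -/
def Tree.graft {m : ℕ} : Tree m → (ℕ → Tree m) → Tree m
  | .leaf, G => G 0
  | .node c, G => .node fun j =>
      (c j).graft fun n => G ((∑ l ∈ Finset.univ.filter (· < j), (c l).leaves) + n)

/-- Indexed `(m+1)`-ary forests: sequences `(T₁, T₂, …)` of trees, almost all of them trivial.
The leaves of the whole forest are numbered `1, 2, 3, …` from left to right. -/
@[ext] structure Forest (m : ℕ) : Type where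
  tree : ℕ+ → Tree m
  finite : {i | tree i ≠ Tree.leaf}.Finite

namespace Forest

variable {m : ℕ}

/-- The number of leaves of the forest to the left of the tree `T_i`. -/
def offset (F : Forest m) (i : ℕ+) : ℕ := ∑ l ∈ Finset.Ico 1 i, (F.tree l).leaves

/-- The empty forest, all of whose trees are trivial. -/
instance : One (Forest m) := ⟨⟨fun _ => .leaf, by simp⟩⟩

theorem leaves_pos (t : Tree m) : 0 < t.leaves := by
  induction t with
  | leaf => simp [Tree.leaves]
  | node c ih =>
    rw [Tree.leaves]
    exact lt_of_lt_of_le (ih 0)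
      (Finset.single_le_sum (f := fun j => (c j).leaves) (fun _ _ => Nat.zero_le _)
        (Finset.mem_univ 0))

theorem le_offset (F : Forest m) (i : ℕ+) : (i : ℕ) ≤ F.offset i + 1 := by
  have h : (Finset.Ico 1 i).card • 1 ≤ F.offset i :=
    Finset.card_nsmul_le_sum _ _ _ fun l _ => leaves_pos (F.tree l)
  simp only [PNat.card_Ico, smul_eq_mul, mul_one, PNat.one_coe] at h
  omega

/-- The product `F · G`: the `i`-th leaf of `F` is identified with the `i`-th root of `G`.
The leaf number `n` (from zero) of `F.tree i` is the leaf `F.offset i + n + 1` of `F`. -/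
instance : Mul (Forest m) where
  mul F G :=
    { tree := fun i => (F.tree i).graft fun n => G.tree (Nat.succPNat (F.offset i + n))
      finite := by
        obtain ⟨N, hN⟩ := G.finite.bddAbove
        refine (F.finite.union (Set.finite_Iic N)).subset fun i hi => ?_
        by_contra hc
        simp only [Set.mem_union, Set.mem_ofPred_eq, Set.mem_Iic, not_or, not_not, not_le] at hc
        obtain ⟨h1, h2⟩ := hc
        simp only [Set.mem_ofPred_eq, h1, Tree.graft] at hi
        have h3 := PNat.coe_le_coe _ _ |>.2 (hN (by simpa using hi))
        have h4 := le_offset F i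
        have h5 := PNat.coe_lt_coe _ _ |>.2 h2
        simp only [Nat.succPNat_coe] at h3
        omega }

/-- The forest `i̲` with a single internal node, whose leftmost child is the leaf `i`. -/
def single (m : ℕ) (i : ℕ+) : Forest m where
  tree := fun j => if j = i then .node fun _ => .leaf else .leaf
  finite := (Set.finite_singleton i).subset fun j hj => by
    by_contra h
    simp_all

/-- The trimming sequences of `F`. Trimming `F` at `i`, i.e. deleting a terminal node with leftmost
leaf `i`, yields `F/i = G` exactly when `F = G · i̲`. So `(i₁, …, i_k)` is a trimming sequence,
i.e. `(((F/i_k)/i_{k-1})/⋯)/i₁` is the empty forest, when `F = i̲₁ · i̲₂ ⋯ i̲_k`. -/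
def trim (F : Forest m) : Set (List ℕ+) :=
  {l | l.foldl (fun G i => G * single m i) 1 = F}

end Forest

/-- A family of homogeneous polynomials indexed by `(m+1)`-ary indexed forests is dual to the
operators `T_i^{(m)}`: `P_∅ = 1`, and `T_i^{(m)} P_F = P_{F/i}` if `F/i` is defined (that is, if
`F = G · i̲` for some `G = F/i`) and `T_i^{(m)} P_F = 0` otherwise. -/
structure IsForestFamily (m : ℕ) (P : Forest m → Pol) : Prop where
  homogeneous : ∀ F, ∃ d : ℕ, (P F).IsHomogeneous d
  empty : P 1 = 1
  trim : ∀ (G : Forest m) (i : ℕ+), tope m i (P (G * Forest.single m i)) = P G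
  zero : ∀ (F : Forest m) (i : ℕ+), (¬ ∃ G, F = G * Forest.single m i) → tope m i (P F) = 0

/-! ### Exactness of the division -/

theorem rope_pow_X (i : ℕ+) (m : ℕ) (j : ℕ+) :
    (rope i ^ m) (X j) = if j < i then X j
      else if (j : ℕ) < i + m then 0 else X (Nat.toPNat' (j - m)) := by
  induction m generalizing j with
  | zero => simp
  | succ m ih =>
    rw [pow_succ, AlgHom.mul_apply]
    by_cases h1 : j < i
    · have : rope i (X j) = X j := by simp [rope, h1]
      rw [this, ih, if_pos h1, if_pos h1]
    · by_cases h2 : j = i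
      · have : rope i (X j) = 0 := by simp [rope, h2]
        rw [this, map_zero, if_neg h1, if_pos]
        subst h2
        omega
      · have : rope i (X j) = X (j - 1) := by simp [rope, h1, h2]
        have h3 : i < j := lt_of_le_of_ne (not_lt.1 h1) (Ne.symm h2)
        have h4 : 1 < j := lt_of_le_of_lt (show (1 : ℕ+) ≤ i from one_le) h3
        have h5 : ((j - 1 : ℕ+) : ℕ) = j - 1 := by rw [PNat.sub_coe, if_pos h4]; rfl
        have h6 : (i : ℕ) < j := h3
        have h7 : ¬ (j - 1 < i) := by
          rw [← PNat.coe_lt_coe, h5]; omega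
        rw [this, ih, if_neg h1, if_neg h7, h5]
        congr 1
        · simp only [eq_iff_iff]; omega
        · congr 2; omega

theorem X_mul_tope (m : ℕ) (i : ℕ+) (f : Pol) :
    X i * tope m i f = (rope (i + 1) ^ m) f - (rope i ^ m) f := by
  have key : ((Ideal.Quotient.mkₐ ℤ (Ideal.span {(X i : Pol)})).comp (rope (i + 1) ^ m)) =
      (Ideal.Quotient.mkₐ ℤ (Ideal.span {(X i : Pol)})).comp (rope i ^ m) := by
    apply MvPolynomial.algHom_ext
    intro j
    have hX : Ideal.Quotient.mk (Ideal.span {(X i : Pol)}) (X i) = 0 :=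
      Ideal.Quotient.eq_zero_iff_mem.2 (Ideal.mem_span_singleton_self _)
    have hs : ((i + 1 : ℕ+) : ℕ) = i + 1 := rfl
    simp only [AlgHom.comp_apply, rope_pow_X, Ideal.Quotient.mkₐ_eq_mk, ← PNat.coe_lt_coe]
    rcases lt_trichotomy (j : ℕ) i with h | h | h
    · rw [if_pos h, if_pos (by omega)]
    · have : j = i := PNat.coe_injective h
      subst this
      rcases Nat.eq_zero_or_pos m with rfl | hm
      · simp
      · rw [if_pos (by omega), if_neg (by omega), if_pos (by omega), hX, map_zero]
    · rw [if_neg (show ¬ (j : ℕ) < (i + 1 : ℕ+) by omega),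
        if_neg (show ¬ (j : ℕ) < (i : ℕ) by omega)]
      by_cases h1 : (j : ℕ) < i + m
      · rw [if_pos (show (j : ℕ) < (i + 1 : ℕ+) + m by omega), if_pos h1]
      · rw [if_neg h1]
        by_cases h2 : (j : ℕ) < (i + 1 : ℕ+) + m
        · have : Nat.toPNat' (j - m) = i := by
            apply PNat.coe_injective
            have := i.pos
            rw [Nat.toPNat'_coe, if_pos (by omega)]
            omega
          rw [if_pos h2, this, hX, map_zero]
        · rw [if_neg h2]
  have hdvd : (X i : Pol) ∣ (rope (i + 1) ^ m) f - (rope i ^ m) f := by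
    rw [← Ideal.mem_span_singleton, ← Ideal.Quotient.eq]
    exact DFunLike.congr_fun key f
  obtain ⟨g, hg⟩ := hdvd
  have : tope m i f = g := by
    change ((rope (i + 1) ^ m) f - (rope i ^ m) f).divMonomial (Finsupp.single i 1) = g
    rw [hg, X_mul_divMonomial]
  rw [this, hg]

end MSlides

open MSlides

namespace MSlides

open MvPolynomial

/-! ### Substitutions -/

/-! Slides. On a monomial in `x₁, …, x_p`, the creator `B_p` chooses an admissible `t`, turns every
`x_p` into `x_t` and multiplies by one more `x_t`. On compatible sequences this replaces the entries
equal to `p` by `t` and appends `t`. It is inverted by turning the entries equal to the last one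
back into `p`, so `B_p` appends `p` to the index of a slide polynomial (`builder_slide`).

Creation. By linearity it suffices to treat `x^e x_a^{p+1}` with `e` supported below `a`. At most
two extractors act nontrivially: `D_a` gives `x^e x_a^p`, and `D_{a-m}` gives `-x^e x_{a-m}^p` if `a
- m` lies above the support of `e`. The two sums produced by `B_a` and `B_{a-m}` differ only in the
term at `x_a`, which is the original monomial (`builder_dope_monomial`). As `B_i` ignores monomials
with variables beyond `x_i`, the truncation in `D_i` is harmless and `B_i D_i = B_i T_i`.

Forest polynomials. Uniqueness follows by induction on the number of nodes, since `f = ∑ B_i T_i f`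
recovers `f` from its images `T_i f`. For existence, set `P_F = ∑ B_i P_{F/i}`, the sum of slides
over `Trim(F)`. That `T_j` returns `P_{F/j}` is an integrability statement: the `T_i` and the
generators `i̲` obey the same Thompson relations (`tope_tope`, `single_mul_single`), and a
leading-variable argument (`eq_zero_of_sum_builder_eq_zero`) shows that these relations suffice
(`tope_finsum_builder`). On the forest side one needs that every forest is a product of generators,
that the number of factors is determined by the forest, and that generators cancel on the right, so
that `F/i` is well defined. -/

theorem algHom_monomial_of_fixed (φ : Pol →ₐ[ℤ] Pol) {d : ℕ+ →₀ ℕ} (c : ℤ)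
    (h : ∀ l ∈ d.support, φ (X l) = X l) : φ (monomial d c) = monomial d c := by
  rw [monomial_eq, map_mul, Finsupp.prod, map_prod]
  congr 1
  · simp
  · exact Finset.prod_congr rfl fun l hl => by rw [map_pow, h l hl]

theorem algHom_monomial_of_killed (φ : Pol →ₐ[ℤ] Pol) {d : ℕ+ →₀ ℕ} (c : ℤ) {l : ℕ+}
    (hl : l ∈ d.support) (h : φ (X l) = 0) : φ (monomial d c) = 0 := by
  rw [monomial_eq, map_mul, Finsupp.prod, map_prod]
  refine mul_eq_zero_of_right _ (Finset.prod_eq_zero hl ?_)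
  rw [map_pow, h, zero_pow (Finsupp.mem_support_iff.1 hl)]

theorem trunc_X (i j : ℕ+) : trunc i (X j) = if j < i then X j else 0 := by
  simp [trunc]

theorem trunc_X_of_lt {i j : ℕ+} (h : j < i) : trunc i (X j) = X j := by
  rw [trunc_X, if_pos h]

theorem trunc_X_of_le {i j : ℕ+} (h : i ≤ j) : trunc i (X j) = 0 := by
  rw [trunc_X, if_neg (not_lt.2 h)]

theorem trunc_monomial_of_lt {n : ℕ+} {d : ℕ+ →₀ ℕ} (c : ℤ) (h : ∀ l ∈ d.support, l < n) :
    trunc n (monomial d c) = monomial d c :=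
  algHom_monomial_of_fixed _ c fun l hl => trunc_X_of_lt (h l hl)

theorem trunc_monomial_of_le {n l : ℕ+} {d : ℕ+ →₀ ℕ} (c : ℤ) (hl : l ∈ d.support) (h : n ≤ l) :
    trunc n (monomial d c) = 0 :=
  algHom_monomial_of_killed _ c hl (trunc_X_of_le h)

theorem trunc_trunc {a b : ℕ+} (h : a ≤ b) (f : Pol) : trunc b (trunc a f) = trunc a f := by
  have : (trunc b).comp (trunc a) = trunc a := by
    refine algHom_ext fun j => ?_
    rw [AlgHom.comp_apply, trunc_X]
    split_ifs with h1
    · exact trunc_X_of_lt (h1.trans_le h)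
    · simp
  exact DFunLike.congr_fun this f

theorem trunc_mono {a b : ℕ+} (h : a ≤ b) {f : Pol} (hf : trunc a f = f) : trunc b f = f := by
  rw [← hf, trunc_trunc h]

theorem exists_trunc_eq (f : Pol) : ∃ n : ℕ+, trunc n f = f := by
  induction f using MvPolynomial.induction_on' with
  | monomial d c =>
    obtain ⟨N, hN⟩ := d.support.bddAbove
    exact ⟨N + 1, trunc_monomial_of_lt c fun l hl => PNat.lt_add_one_iff.2 (hN hl)⟩
  | add f g hf hg =>
    obtain ⟨a, ha⟩ := hf
    obtain ⟨b, hb⟩ := hg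
    exact ⟨max a b, by
      rw [map_add, trunc_mono (le_max_left a b) ha, trunc_mono (le_max_right a b) hb]⟩

theorem rope_pow_trunc (m : ℕ) {n i : ℕ+} (h : n ≤ i) (f : Pol) :
    (rope i ^ m) (trunc n f) = trunc n f := by
  have : (rope i ^ m).comp (trunc n) = trunc n := by
    refine algHom_ext fun j => ?_
    rw [AlgHom.comp_apply, trunc_X]
    split_ifs with h1
    · rw [rope_pow_X, if_pos (h1.trans_le h)]
    · simp
  exact DFunLike.congr_fun this f

theorem trunc_rope_pow (m : ℕ) (i : ℕ+) (f : Pol) : trunc i ((rope i ^ m) f) = trunc i f := by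
  have : (trunc i).comp (rope i ^ m) = trunc i := by
    refine algHom_ext fun j => ?_
    rw [AlgHom.comp_apply, rope_pow_X]
    split_ifs with h1 h2
    · rfl
    · rw [map_zero, trunc_X_of_le (not_lt.1 h1)]
    · rw [trunc_X_of_le (not_lt.1 h1), trunc_X_of_le]
      simp only [← PNat.coe_lt_coe, ← PNat.coe_le_coe, Nat.toPNat'_coe] at *
      have := i.pos
      split_ifs <;> omega
  exact DFunLike.congr_fun this f

theorem rope_pow_X_of_lt (m : ℕ) {i j : ℕ+} (h : j < i) : (rope i ^ m) (X j) = X j := by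
  rw [rope_pow_X, if_pos h]

theorem rope_pow_X_add (m : ℕ) {i j k : ℕ+} (h : i ≤ j) (hk : (k : ℕ) = j + m) :
    (rope i ^ m) (X k) = X j := by
  simp only [← PNat.coe_le_coe] at h
  rw [rope_pow_X, if_neg, if_neg (by omega)]
  · congr 1
    apply PNat.coe_injective
    have := j.pos
    rw [Nat.toPNat'_coe, if_pos (by omega)]
    omega
  · rw [← PNat.coe_lt_coe]; omega

/-- Both sides insert two blocks of `m` zeros. The position `a` of the later block becomes `a + m`
when it is counted with the earlier block in place. -/
theorem rope_pow_comm (m : ℕ) {a b c : ℕ+} (h : b ≤ a) (hc : (c : ℕ) = a + m) (f : Pol) :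
    (rope a ^ m) ((rope b ^ m) f) = (rope b ^ m) ((rope c ^ m) f) := by
  have : (rope a ^ m).comp (rope b ^ m) = (rope b ^ m).comp (rope c ^ m) := by
    refine algHom_ext fun j => ?_
    rw [AlgHom.comp_apply, AlgHom.comp_apply]
    rw [← PNat.coe_le_coe] at h
    have hj := j.pos
    rcases lt_or_ge (j : ℕ) b with h1 | h1
    · rw [rope_pow_X_of_lt m (i := b) (PNat.coe_lt_coe _ _ |>.1 h1), rope_pow_X_of_lt,
        rope_pow_X_of_lt, rope_pow_X_of_lt] <;> rw [← PNat.coe_lt_coe] <;> omega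
    rcases lt_or_ge (j : ℕ) (b + m) with h2 | h2
    · have h3 : (rope b ^ m) (X j) = 0 := by
        rw [rope_pow_X, if_neg, if_pos h2]
        rw [← PNat.coe_lt_coe]; omega
      rw [h3, rope_pow_X_of_lt m (i := c), h3, map_zero]
      rw [← PNat.coe_lt_coe]; omega
    have hb := b.pos
    obtain ⟨k, hk⟩ : ∃ k : ℕ+, (j : ℕ) = k + m := ⟨⟨j - m, by omega⟩, by simp; omega⟩
    have hbk : b ≤ k := by rw [← PNat.coe_le_coe]; omega
    rw [rope_pow_X_add m hbk hk]
    rcases lt_or_ge (k : ℕ) a with h3 | h3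
    · rw [rope_pow_X_of_lt, rope_pow_X_of_lt, rope_pow_X_add m hbk hk] <;>
        rw [← PNat.coe_lt_coe] <;> omega
    rcases lt_or_ge (k : ℕ) (a + m) with h4 | h4
    · have h5 : (rope a ^ m) (X k) = 0 := by
        rw [rope_pow_X, if_neg, if_pos h4]
        rw [← PNat.coe_lt_coe]; omega
      have h6 : (rope c ^ m) (X j) = 0 := by
        rw [rope_pow_X, if_neg, if_pos (by omega)]
        rw [← PNat.coe_lt_coe]; omega
      rw [h5, h6, map_zero]
    obtain ⟨r, hr⟩ : ∃ r : ℕ+, (k : ℕ) = r + m :=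
      ⟨⟨k - m, by have := a.pos; omega⟩, by simp; omega⟩
    rw [rope_pow_X_add m (j := r) _ hr, rope_pow_X_add m (j := k) _ hk,
      rope_pow_X_add m (j := r) _ hr] <;> rw [← PNat.coe_le_coe] <;> omega
  exact DFunLike.congr_fun this f

/-! ### Divided differences -/

theorem tope_X_mul (m : ℕ) {i j : ℕ+} (h : j < i) (f : Pol) :
    tope m i (X j * f) = X j * tope m i f := by
  apply mul_left_cancel₀ (X_ne_zero (R := ℤ) i)
  rw [X_mul_tope, map_mul, map_mul, rope_pow_X_of_lt m h,
    rope_pow_X_of_lt m (h.trans (PNat.lt_add_right i 1)), mul_left_comm, X_mul_tope, mul_sub]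

/-- The divided differences satisfy the relations of the `m`-Thompson monoid. -/
theorem tope_tope (m : ℕ) {i j k : ℕ+} (h : j < i) (hk : (k : ℕ) = i + m) (f : Pol) :
    tope m i (tope m j f) = tope m j (tope m k f) := by
  apply mul_left_cancel₀ (X_ne_zero (R := ℤ) j)
  apply mul_left_cancel₀ (X_ne_zero (R := ℤ) i)
  have hk1 : ((k + 1 : ℕ+) : ℕ) = (i + 1 : ℕ+) + m := by
    simp only [PNat.add_coe, PNat.one_coe]; omega
  have hj1 : j + 1 ≤ i := PNat.add_one_le_iff.2 h
  have hi1 : i ≤ i + 1 := (PNat.lt_add_right i 1).le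
  -- Clearing denominators turns each side into a signed sum of four double insertions, which
  -- `rope_pow_comm` matches term by term.
  have e1 : X i * (X j * tope m i (tope m j f)) =
      ((rope (i + 1) ^ m) ((rope (j + 1) ^ m) f) - (rope (i + 1) ^ m) ((rope j ^ m) f)) -
      ((rope i ^ m) ((rope (j + 1) ^ m) f) - (rope i ^ m) ((rope j ^ m) f)) := by
    rw [← tope_X_mul m h, X_mul_tope, X_mul_tope, map_sub, map_sub]
  have e2 : X i * (X j * tope m j (tope m k f)) =
      ((rope (j + 1) ^ m) ((rope (k + 1) ^ m) f) - (rope (j + 1) ^ m) ((rope k ^ m) f)) -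
      ((rope j ^ m) ((rope (k + 1) ^ m) f) - (rope j ^ m) ((rope k ^ m) f)) := by
    rw [X_mul_tope, mul_sub]
    -- Since `j + 1 ≤ i`, both `R_{j+1}^m` and `R_j^m` send `x_k` to `x_i`. So the factor `x_i` can
    -- be pulled inside as `x_k`, where it cancels the denominator of `T_k`.
    nth_rw 1 [← rope_pow_X_add m hj1 hk]
    rw [← rope_pow_X_add m h.le hk, ← map_mul, ← map_mul, X_mul_tope, map_sub, map_sub]
  rw [e1, e2, rope_pow_comm m (hj1.trans hi1) hk1, rope_pow_comm m (h.le.trans hi1) hk1,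
    rope_pow_comm m hj1 hk, rope_pow_comm m h.le hk]
  ring

theorem tope_eq_zero_of_trunc_eq (m : ℕ) {n i : ℕ+} (h : n ≤ i) {f : Pol} (hf : trunc n f = f) :
    tope m i f = 0 := by
  apply mul_left_cancel₀ (X_ne_zero (R := ℤ) i)
  rw [X_mul_tope, ← hf, rope_pow_trunc m h, rope_pow_trunc m (h.trans (PNat.lt_add_right i 1).le),
    sub_self, mul_zero]

theorem tope_C (m : ℕ) (i : ℕ+) (c : ℤ) : tope m i (C c) = 0 :=
  tope_eq_zero_of_trunc_eq m (n := 1) one_le (by simp [trunc])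

/-- The truncation `R_{i+1}^∞` fixes `x_i` and absorbs `R_{i+1}^m`. The next four lemmas evaluate
this difference on a monomial with largest variable `x_a`. -/
theorem X_mul_dope (m : ℕ) (i : ℕ+) (f : Pol) :
    X i * dope m i f = trunc (i + 1) f - trunc (i + 1) ((rope i ^ m) f) := by
  have h : X i * dope m i f = trunc (i + 1) (X i * tope m i f) := by
    rw [map_mul, trunc_X_of_lt (PNat.lt_add_right i 1)]
    rfl
  rw [h, X_mul_tope, map_sub, trunc_rope_pow]

theorem dope_self (m : ℕ) (hm : 1 ≤ m) {a : ℕ+} {e : ℕ+ →₀ ℕ} (he : ∀ l ∈ e.support, l < a)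
    (p : ℕ) : dope m a (monomial e 1 * X a ^ (p + 1)) = monomial e 1 * X a ^ p := by
  apply mul_left_cancel₀ (X_ne_zero (R := ℤ) a)
  have h0 : (rope a ^ m) (X a) = 0 := by
    rw [rope_pow_X, if_neg (lt_irrefl _), if_pos (by omega)]
  have ha := PNat.lt_add_right a 1
  rw [X_mul_dope, map_mul, map_mul, map_mul, map_pow (rope a ^ m), h0,
    trunc_monomial_of_lt 1 fun l hl => (he l hl).trans ha, map_pow, trunc_X_of_lt ha,
    zero_pow p.succ_ne_zero, map_zero, mul_zero, sub_zero]
  ring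

theorem dope_of_gt (m : ℕ) {a i : ℕ+} {e : ℕ+ →₀ ℕ} (he : ∀ l ∈ e.support, l < a)
    (p : ℕ) (h : a < i) : dope m i (monomial e 1 * X a ^ (p + 1)) = 0 := by
  have h0 : trunc i (monomial e 1 * X a ^ (p + 1)) = monomial e 1 * X a ^ (p + 1) := by
    rw [map_mul, map_pow, trunc_X_of_lt h, trunc_monomial_of_lt 1 fun l hl => (he l hl).trans h]
  rw [dope, LinearMap.comp_apply, tope_eq_zero_of_trunc_eq m le_rfl h0, map_zero]

theorem dope_add (m : ℕ) {a i : ℕ+} {e : ℕ+ →₀ ℕ} (he : ∀ l ∈ e.support, l < i)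
    (p : ℕ) (h : i < a) (ha : (a : ℕ) = i + m) :
    dope m i (monomial e 1 * X a ^ (p + 1)) = -(monomial e 1 * X i ^ p) := by
  apply mul_left_cancel₀ (X_ne_zero (R := ℤ) i)
  have hi := PNat.lt_add_right i 1
  rw [X_mul_dope, map_mul, map_mul, map_mul, map_pow (rope i ^ m), rope_pow_X_add m le_rfl ha,
    algHom_monomial_of_fixed (rope i ^ m) 1 fun l hl => rope_pow_X_of_lt m (he l hl),
    trunc_monomial_of_lt 1 fun l hl => (he l hl).trans hi, map_pow, map_pow, trunc_X_of_lt hi,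
    trunc_X_of_le (PNat.add_one_le_iff.2 h), zero_pow p.succ_ne_zero, mul_zero, zero_sub]
  ring

theorem dope_of_lt (m : ℕ) {a i : ℕ+} {e : ℕ+ →₀ ℕ} (he : ∀ l ∈ e.support, l < a)
    (p : ℕ) (h : i < a) (hne : ¬ ((a : ℕ) = i + m ∧ ∀ l ∈ e.support, l < i)) :
    dope m i (monomial e 1 * X a ^ (p + 1)) = 0 := by
  apply mul_left_cancel₀ (X_ne_zero (R := ℤ) i)
  rw [X_mul_dope, mul_zero, map_mul (trunc (i + 1)), map_pow,
    trunc_X_of_le (PNat.add_one_le_iff.2 h), zero_pow p.succ_ne_zero, mul_zero, zero_sub,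
    neg_eq_zero]
  have h' := h
  rw [← PNat.coe_lt_coe] at h'
  -- If `a = i + m`, some variable of `x^e` lies in the block of positions `i, …, i + m - 1` that
  -- `R_i^m` sets to zero. Otherwise `x_a` itself is killed, or it is shifted to a variable still
  -- beyond `x_i` and then truncated.
  by_cases ha : (a : ℕ) = i + m
  · obtain ⟨l, hl, hli⟩ : ∃ l ∈ e.support, i ≤ l := by
      by_contra! hc
      exact hne ⟨ha, hc⟩
    have h0 : (rope i ^ m) (X l) = 0 := by
      have := he l hl
      rw [← PNat.coe_lt_coe] at this
      rw [rope_pow_X, if_neg (not_lt.2 hli), if_pos (by omega)]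
    rw [map_mul, algHom_monomial_of_killed _ 1 hl h0, zero_mul, map_zero]
  · rw [map_mul, map_mul, map_pow, map_pow]
    refine mul_eq_zero_of_right _ ?_
    have h0 : trunc (i + 1) ((rope i ^ m) (X a)) = 0 := by
      rw [rope_pow_X, if_neg (not_lt.2 h.le)]
      split_ifs with h1
      · exact map_zero _
      · apply trunc_X_of_le
        rw [← PNat.coe_le_coe, Nat.toPNat'_coe, if_pos (by omega), PNat.add_coe, PNat.one_coe]
        omega
    rw [h0, zero_pow p.succ_ne_zero]

/-! ### Slide creators -/

theorem builder_monomial (m : ℕ) (a : ℕ+) (d : ℕ+ →₀ ℕ) (c : ℤ) :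
    builder m a (monomial d c) = c • builderMonomial m a d := by
  have h : monomial d c = c • basisMonomials ℕ+ ℤ d := by
    simp [smul_monomial]
  rw [h, map_zsmul, builder, Module.Basis.constr_basis]

/-- The possible indices of the new variable when `B_a` is applied to `x^e x_a^p`. -/
def slots (m : ℕ) (e : ℕ+ →₀ ℕ) (a : ℕ+) : Finset ℕ+ :=
  (Finset.Icc 1 a).filter
    (fun k : ℕ+ => (k : ℕ) ≡ (a : ℕ) [MOD m] ∧ ∀ l ∈ e.support, l < k)

theorem mem_slots {m : ℕ} {e : ℕ+ →₀ ℕ} {a k : ℕ+} :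
    k ∈ slots m e a ↔ k ≤ a ∧ (k : ℕ) ≡ (a : ℕ) [MOD m] ∧ ∀ l ∈ e.support, l < k := by
  simp [slots]

theorem builderMonomial_of_le (m : ℕ) {a : ℕ+} {d : ℕ+ →₀ ℕ} (h : ∀ l ∈ d.support, l ≤ a) :
    builderMonomial m a d =
      monomial (d.erase a) 1 * ∑ k ∈ slots m (d.erase a) a, X k ^ (d a + 1) :=
  if_pos h

theorem builder_mul_pow (m : ℕ) {a : ℕ+} {e : ℕ+ →₀ ℕ} (he : ∀ l ∈ e.support, l < a) (p : ℕ) :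
    builder m a (monomial e 1 * X a ^ p) =
      monomial e 1 * ∑ k ∈ slots m e a, X k ^ (p + 1) := by
  have ha : e a = 0 := by
    by_contra h
    exact lt_irrefl a (he a (Finsupp.mem_support_iff.2 h))
  have h1 : (e + Finsupp.single a p).erase a = e := by
    rw [Finsupp.erase_add, Finsupp.erase_single, add_zero, Finsupp.erase_of_notMem_support]
    simpa using ha
  rw [X_pow_eq_monomial, monomial_mul, mul_one, builder_monomial, one_smul,
    builderMonomial_of_le, h1]
  · simp [ha]
  · intro l hl
    by_contra h
    push Not at h
    have h2 : e l = 0 := by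
      by_contra h3
      exact lt_asymm h (he l (Finsupp.mem_support_iff.2 h3))
    simp [h2, h.ne] at hl

/-- An index below `a` and congruent to it is at most `a - m = b`. This is the telescoping behind
the creation identity. -/
theorem slots_add {m : ℕ} (hm : 1 ≤ m) {e : ℕ+ →₀ ℕ} {a b : ℕ+} (hb : ∀ l ∈ e.support, l < b)
    (hab : (a : ℕ) = b + m) : slots m e a = insert a (slots m e b) := by
  ext k
  simp only [Finset.mem_insert, mem_slots, ← PNat.coe_le_coe]
  have hmod : (a : ℕ) ≡ b [MOD m] := by simp [hab, Nat.ModEq]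
  constructor
  · rintro ⟨h1, h2, h3⟩
    rcases h1.eq_or_lt with h | h
    · exact Or.inl (PNat.coe_injective h)
    · right
      refine ⟨?_, h2.trans hmod, h3⟩
      have := (Nat.modEq_iff_dvd' h.le).1 h2
      have := Nat.le_of_dvd (by omega) this
      omega
  · rintro (rfl | ⟨h1, h2, h3⟩)
    · refine ⟨le_rfl, rfl, fun l hl => (hb l hl).trans ?_⟩
      rw [← PNat.coe_lt_coe]; omega
    · exact ⟨by omega, h2.trans hmod.symm, h3⟩

theorem slots_eq_singleton {m : ℕ} {e : ℕ+ →₀ ℕ} {a : ℕ+}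
    (he : ∀ l ∈ e.support, l < a)
    (hne : ∀ b : ℕ+, ¬ ((a : ℕ) = b + m ∧ ∀ l ∈ e.support, l < b)) : slots m e a = {a} := by
  ext k
  simp only [Finset.mem_singleton, mem_slots]
  constructor
  · rintro ⟨h1, h2, h3⟩
    by_contra hk
    have h : (k : ℕ) < a := PNat.coe_lt_coe _ _ |>.2 (lt_of_le_of_ne h1 hk)
    have := Nat.le_of_dvd (by omega) ((Nat.modEq_iff_dvd' h.le).1 h2)
    have hk0 := k.pos
    obtain ⟨b, hb⟩ : ∃ b : ℕ+, (a : ℕ) = b + m := ⟨⟨a - m, by omega⟩, by simp; omega⟩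
    refine hne b ⟨hb, fun l hl => (h3 l hl).trans_le ?_⟩
    rw [← PNat.coe_le_coe]
    omega
  · rintro rfl
    exact ⟨le_rfl, rfl, he⟩

/-- The monomials removed by the truncation are exactly those on which `B_i` vanishes by definition.
This transfers the creation identity from `D_i` to `T_i`. -/
theorem builder_trunc (m : ℕ) (i : ℕ+) (f : Pol) :
    builder m i (trunc (i + 1) f) = builder m i f := by
  induction f using MvPolynomial.induction_on' with
  | monomial d c =>
    by_cases h : ∀ l ∈ d.support, l ≤ i
    · rw [trunc_monomial_of_lt c fun l hl => PNat.lt_add_one_iff.2 (h l hl)]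
    · rw [builder_monomial, builderMonomial, if_neg h, smul_zero]
      push Not at h
      obtain ⟨l, hl, hil⟩ := h
      rw [trunc_monomial_of_le c hl (PNat.add_one_le_iff.2 hil), map_zero]
  | add f g hf hg => rw [map_add, map_add, map_add, hf, hg]

theorem builder_dope (m : ℕ) (i : ℕ+) (f : Pol) :
    builder m i (dope m i f) = builder m i (tope m i f) :=
  builder_trunc m i _

theorem support_erase_lt {d : ℕ+ →₀ ℕ} {a : ℕ+} (h : ∀ l ∈ d.support, l ≤ a) :
    ∀ l ∈ (d.erase a).support, l < a := by
  intro l hl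
  rw [Finsupp.support_erase, Finset.mem_erase] at hl
  exact lt_of_le_of_ne (h l hl.2) hl.1

theorem trunc_builder (m : ℕ) {i n : ℕ+} (h : i < n) (f : Pol) :
    trunc n (builder m i f) = builder m i f := by
  induction f using MvPolynomial.induction_on' with
  | monomial d c =>
    rw [builder_monomial, map_zsmul]
    congr 1
    rw [builderMonomial]
    split_ifs with hd
    · rw [map_mul, map_sum, trunc_monomial_of_lt 1 fun l hl => (support_erase_lt hd l hl).trans h]
      congr 1
      refine Finset.sum_congr rfl fun k hk => ?_
      rw [map_pow, trunc_X_of_lt ((mem_slots.1 hk).1.trans_lt h)]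
    · exact map_zero _
  | add f g hf hg => rw [map_add, map_add, hf, hg]

/-- Up to terms in `x₁, …, x_{i-1}`, the creator `B_i` multiplies by `x_i`. -/
theorem trunc_builder_sub (m : ℕ) (i : ℕ+) (f : Pol) :
    trunc i (builder m i f - X i * trunc (i + 1) f) = builder m i f - X i * trunc (i + 1) f := by
  induction f using MvPolynomial.induction_on' with
  | monomial d c =>
    by_cases h : ∀ l ∈ d.support, l ≤ i
    · have he := support_erase_lt h
      have hi : i ∈ slots m (d.erase i) i := mem_slots.2 ⟨le_rfl, rfl, he⟩
      have hX : X i * monomial d c = c • (monomial (d.erase i) 1 * X i ^ (d i + 1) : Pol) := by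
        have : monomial d c = c • (monomial (d.erase i) 1 * X i ^ d i : Pol) := by
          rw [X_pow_eq_monomial, monomial_mul, Finsupp.erase_add_single, smul_monomial]
          simp
        rw [this, mul_smul_comm]
        congr 1
        ring
      rw [trunc_monomial_of_lt c fun l hl => PNat.lt_add_one_iff.2 (h l hl), builder_monomial,
        builderMonomial_of_le m h, ← Finset.add_sum_erase _ _ hi, hX, ← smul_sub, mul_add,
        add_sub_cancel_left, map_zsmul, map_mul, trunc_monomial_of_lt 1 he, map_sum]
      congr 2
      refine Finset.sum_congr rfl fun k hk => ?_
      rw [Finset.mem_erase, mem_slots] at hk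
      rw [map_pow, trunc_X_of_lt (lt_of_le_of_ne hk.2.1 hk.1)]
    · rw [builder_monomial, builderMonomial, if_neg h, smul_zero]
      push Not at h
      obtain ⟨l, hl, hil⟩ := h
      rw [trunc_monomial_of_le c hl (PNat.add_one_le_iff.2 hil), mul_zero, sub_zero, map_zero]
  | add f g hf hg =>
    rw [map_add, map_add, mul_add, add_sub_add_comm, map_add, hf, hg]

theorem isHomogeneous_builderMonomial (m : ℕ) (a : ℕ+) (d : ℕ+ →₀ ℕ) :
    (builderMonomial m a d).IsHomogeneous (d.degree + 1) := by
  rw [builderMonomial]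
  split_ifs with h
  · have hd : d.degree + 1 = (d.erase a).degree + (d a + 1) := by
      nth_rw 1 [← Finsupp.erase_add_single a d]
      rw [map_add, Finsupp.degree_single, add_assoc]
    rw [hd]
    exact (isHomogeneous_monomial _ rfl).mul
      (IsHomogeneous.sum _ _ _ fun k _ => isHomogeneous_X_pow k _)
  · exact isHomogeneous_zero _ _ _

theorem isHomogeneous_builder (m : ℕ) (a : ℕ+) {f : Pol} {d : ℕ} (hf : f.IsHomogeneous d) :
    (builder m a f).IsHomogeneous (d + 1) := by
  rw [f.as_sum, map_sum]
  refine IsHomogeneous.sum _ _ _ fun s hs => ?_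
  rw [builder_monomial, smul_eq_C_mul]
  have hs' : s.degree = d := by
    rw [Finsupp.degree_eq_weight_one]
    exact hf (mem_support_iff.1 hs)
  rw [← hs']
  have := (isHomogeneous_C ℕ+ (coeff s f)).mul (isHomogeneous_builderMonomial m a s)
  rwa [zero_add] at this

theorem constantCoeff_builder (m : ℕ) (a : ℕ+) (f : Pol) :
    constantCoeff (builder m a f) = 0 := by
  induction f using MvPolynomial.induction_on' with
  | monomial d c =>
    exact (isHomogeneous_builder m a (isHomogeneous_monomial (d := d) c rfl)).coeff_eq_zero
      (by simp)
  | add f g hf hg => rw [map_add, map_add, hf, hg, add_zero]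

/-! ### The creation identity -/

theorem builder_dope_monomial (m : ℕ) (hm : 1 ≤ m) {a : ℕ+} {e : ℕ+ →₀ ℕ}
    (he : ∀ l ∈ e.support, l < a) (p : ℕ) :
    (Function.support fun i =>
      builder m i (dope m i (monomial e 1 * X a ^ (p + 1)))).Finite ∧
    ∑ᶠ i, builder m i (dope m i (monomial e 1 * X a ^ (p + 1))) = monomial e 1 * X a ^ (p + 1) := by
  by_cases h : ∃ b : ℕ+, (a : ℕ) = b + m ∧ ∀ l ∈ e.support, l < b
  · obtain ⟨b, hab, hb⟩ := h
    have hba : b < a := by rw [← PNat.coe_lt_coe]; omega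
    have hsupp : (Function.support fun i =>
        builder m i (dope m i (monomial e 1 * X a ^ (p + 1)))) ⊆ ({a, b} : Finset ℕ+) := by
      intro i hi
      by_contra hc
      simp only [Finset.coe_insert, Finset.coe_singleton, Set.mem_insert_iff,
        Set.mem_singleton_iff, not_or] at hc
      apply hi
      rcases lt_or_gt_of_ne hc.1 with h1 | h1
      · simp only [dope_of_lt m he p h1 fun h2 => hc.2 (PNat.coe_injective (by omega)), map_zero]
      · simp only [dope_of_gt m he p h1, map_zero]
    refine ⟨(Finset.finite_toSet _).subset hsupp, ?_⟩
    have ha : a ∉ slots m e b := fun h => not_le.2 hba (mem_slots.1 h).1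
    rw [finsum_eq_sum_of_support_subset _ hsupp, Finset.sum_pair hba.ne', dope_self m hm he,
      dope_add m hb p hba hab, map_neg, builder_mul_pow m he, builder_mul_pow m hb,
      slots_add hm hb hab, Finset.sum_insert ha]
    ring
  · have hz : ∀ i, i ≠ a → builder m i (dope m i (monomial e 1 * X a ^ (p + 1))) = 0 := by
      intro i hi
      rcases lt_or_gt_of_ne hi with h1 | h1
      · rw [dope_of_lt m he p h1 fun h2 => h ⟨i, h2⟩, map_zero]
      · rw [dope_of_gt m he p h1, map_zero]
    refine ⟨(Set.finite_singleton a).subset fun i hi => ?_, ?_⟩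
    · by_contra hc
      exact hi (hz i hc)
    · rw [finsum_eq_single _ a hz, dope_self m hm he, builder_mul_pow m he,
        slots_eq_singleton he fun b hb => h ⟨b, hb⟩, Finset.sum_singleton]

theorem finite_and_finsum_builder_dope (m : ℕ) (hm : 1 ≤ m) (f : Pol) (hf : constantCoeff f = 0) :
    (Function.support fun i => builder m i (dope m i f)).Finite ∧
      ∑ᶠ i, builder m i (dope m i f) = f := by
  have hsum : ∀ s : Finset (ℕ+ →₀ ℕ), (0 : ℕ+ →₀ ℕ) ∉ s →
      (Function.support fun i => builder m i (dope m i (∑ d ∈ s, monomial d (coeff d f)))).Finite ∧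
      ∑ᶠ i, builder m i (dope m i (∑ d ∈ s, monomial d (coeff d f))) =
        ∑ d ∈ s, monomial d (coeff d f) := by
    intro s
    induction s using Finset.induction_on with
    | empty => simp
    | insert d s hd ih =>
      intro h0
      rw [Finset.mem_insert, not_or] at h0
      obtain ⟨ih1, ih2⟩ := ih h0.2
      have hne : d.support.Nonempty := Finsupp.support_nonempty_iff.2 (Ne.symm h0.1)
      -- The exponent is nonzero because the constant term vanishes, so the monomial has a largest
      -- variable `x_a`, and it occurs with positive exponent.
      set a := d.support.max' hne
      have hle : ∀ l ∈ d.support, l ≤ a := fun l hl => Finset.le_max' _ l hl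
      obtain ⟨p, hp⟩ := Nat.exists_eq_succ_of_ne_zero
        (Finsupp.mem_support_iff.1 (d.support.max'_mem hne))
      have hmon : monomial d (coeff d f) =
          coeff d f • (monomial (d.erase a) 1 * X a ^ (p + 1) : Pol) := by
        rw [X_pow_eq_monomial, monomial_mul, ← Nat.succ_eq_add_one, ← hp,
          Finsupp.erase_add_single, smul_monomial]
        simp
      obtain ⟨k1, k2⟩ := builder_dope_monomial m hm (support_erase_lt hle) p
      have hfun : (fun i => builder m i (dope m i (∑ d ∈ insert d s, monomial d (coeff d f)))) =
          fun i => coeff d f •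
            builder m i (dope m i (monomial (d.erase a) 1 * X a ^ (p + 1) : Pol)) +
            builder m i (dope m i (∑ d ∈ s, monomial d (coeff d f))) := by
        funext i
        rw [Finset.sum_insert hd, hmon, map_add, map_add, map_zsmul, map_zsmul]
      have k3 : (Function.support fun i => coeff d f •
          builder m i (dope m i (monomial (d.erase a) 1 * X a ^ (p + 1) : Pol))).Finite :=
        k1.subset (Function.support_const_smul_subset _ _)
      rw [hfun]
      refine ⟨(k3.union ih1).subset (Function.support_add _ _), ?_⟩
      rw [finsum_add_distrib k3 ih1, ih2, ← smul_finsum, k2, ← hmon, Finset.sum_insert hd]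
  have := hsum f.support (by
    rw [mem_support_iff, not_not]
    exact hf)
  rwa [← f.as_sum] at this

theorem isCreationFor_dope (m : ℕ) (hm : 1 ≤ m) : IsCreationFor (builder m) (dope m) :=
  ⟨fun i _ _ hf => isHomogeneous_builder m i hf, finite_and_finsum_builder_dope m hm⟩

theorem isCreationFor_tope (m : ℕ) (hm : 1 ≤ m) : IsCreationFor (builder m) (tope m) := by
  have h := isCreationFor_dope m hm
  refine ⟨h.1, fun f hf => ?_⟩
  simp only [← builder_dope]
  exact h.2 f hf

/-- A polynomial killed by `T_i` for `i ≥ n` involves only `x₁, …, x_{n-1}`. -/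
theorem trunc_eq_of_tope_eq_zero (m : ℕ) (hm : 1 ≤ m) {n : ℕ+} {f : Pol}
    (h : ∀ i, n ≤ i → tope m i f = 0) : trunc n f = f := by
  have hc : ∀ c : ℤ, trunc n (C c) = C c := fun c => by simp [trunc]
  have ht : ∀ i, tope m i (f - C (constantCoeff f)) = tope m i f := fun i => by
    rw [map_sub, tope_C, sub_zero]
  obtain ⟨h1, h2⟩ := (isCreationFor_tope m hm).2 (f - C (constantCoeff f)) (by simp)
  have h3 : trunc n (f - C (constantCoeff f)) = f - C (constantCoeff f) := by
    rw [← h2, finsum_eq_sum _ h1, map_sum]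
    refine Finset.sum_congr rfl fun i _ => ?_
    rcases lt_or_ge i n with hi | hi
    · exact trunc_builder m hi _
    · rw [ht, h i hi, map_zero, map_zero]
  rwa [map_sub, hc, sub_left_inj] at h3

/-- Let `N` be the largest index with `h N ≠ 0`. The relations confine `h N` to the variables `x₁,
…, x_N`, so `B_N (h N)` equals `x_N h N` up to terms in `x₁, …, x_{N-1}`. The other summands involve
only those smaller variables and cannot cancel `x_N h N`. -/
theorem eq_zero_of_sum_builder_eq_zero (m : ℕ) (hm : 1 ≤ m) {h : ℕ+ → Pol}
    (hfin : (Function.support h).Finite)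
    (hrel : ∀ i j k : ℕ+, j < i → (k : ℕ) = i + m → tope m i (h j) = tope m j (h k))
    (hsum : ∑ᶠ i, builder m i (h i) = 0) : h = 0 := by
  by_contra hne
  obtain ⟨N, hN⟩ := hfin.exists_maximal (Function.support_nonempty_iff.2 hne)
  have hbig : ∀ i, N < i → h i = 0 := fun i hi => by
    by_contra hc
    exact hN.not_gt hc hi
  -- For `i > N`, the relation gives `T_i (h N) = T_N (h (i + m))`, which vanishes by maximality of
  -- `N`.
  have htr : trunc (N + 1) (h N) = h N := by
    refine trunc_eq_of_tope_eq_zero m hm fun i hi => ?_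
    have hNi : N < i := PNat.add_one_le_iff.1 hi
    obtain ⟨k, hk⟩ : ∃ k : ℕ+, (k : ℕ) = i + m := ⟨⟨i + m, Nat.add_pos_left i.pos m⟩, rfl⟩
    rw [hrel i N k hNi hk, hbig k, map_zero]
    rw [← PNat.coe_lt_coe] at hNi ⊢
    omega
  have hsub : (Function.support fun i => builder m i (h i)) ⊆ (Finset.Icc 1 N : Finset ℕ+) := by
    intro i hi
    simp only [Finset.coe_Icc, Set.mem_Icc]
    refine ⟨one_le, not_lt.1 fun hc => hi ?_⟩
    simp only [hbig i hc, map_zero]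
  rw [finsum_eq_sum_of_support_subset _ hsub,
    ← Finset.add_sum_erase _ _ (Finset.mem_Icc.2 ⟨one_le, le_rfl⟩)] at hsum
  have h1 : trunc N (builder m N (h N)) = builder m N (h N) := by
    rw [eq_neg_of_add_eq_zero_left hsum, map_neg, map_sum]
    congr 1
    refine Finset.sum_congr rfl fun i hi => trunc_builder m ?_ _
    rw [Finset.mem_erase, Finset.mem_Icc] at hi
    exact lt_of_le_of_ne hi.2.2 hi.1
  have h2 := trunc_builder_sub m N (h N)
  rw [htr, map_sub, h1, sub_right_inj, map_mul, trunc_X_of_le le_rfl, zero_mul, zero_eq_mul] at h2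
  exact hN.prop (h2.resolve_left (X_ne_zero N))

/-- The system `T_i f = g_i` is solvable when the right hand sides are compatible with the
relations of the `m`-Thompson monoid. -/
theorem tope_finsum_builder (m : ℕ) (hm : 1 ≤ m) {g : ℕ+ → Pol}
    (hfin : (Function.support g).Finite)
    (hrel : ∀ i j k : ℕ+, j < i → (k : ℕ) = i + m → tope m i (g j) = tope m j (g k)) (j : ℕ+) :
    tope m j (∑ᶠ i, builder m i (g i)) = g j := by
  set f := ∑ᶠ i, builder m i (g i) with hf
  have hfin' : (Function.support fun i => builder m i (g i)).Finite :=
    hfin.subset fun i hi hc => hi (by simp only [hc, map_zero])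
  have hconst : constantCoeff f = 0 := by
    rw [hf, finsum_eq_sum _ hfin', map_sum]
    exact Finset.sum_eq_zero fun i _ => constantCoeff_builder m i _
  obtain ⟨h1, h2⟩ := (isCreationFor_tope m hm).2 f hconst
  obtain ⟨n, hn⟩ := exists_trunc_eq f
  have h3 : (Function.support fun i => tope m i f).Finite := by
    refine (Set.finite_Iic n).subset fun i hi => Set.mem_Iic.2 (not_lt.1 fun hc => hi ?_)
    exact tope_eq_zero_of_trunc_eq m hc.le hn
  -- The creation identity gives `f = ∑ B_i T_i f`, and `f = ∑ B_i g_i` by definition. The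
  -- difference of the two families lies in the kernel of `∑ B_i` and inherits the relations.
  have key : (fun i => tope m i f - g i) = 0 := by
    refine eq_zero_of_sum_builder_eq_zero m hm
      ((h3.union hfin).subset (Function.support_sub _ _)) (fun i j k hij hk => ?_) ?_
    · rw [map_sub, map_sub, tope_tope m hij hk, hrel i j k hij hk]
    · simp only [map_sub]
      rw [finsum_sub_distrib h1 hfin', h2, ← hf, sub_self]
  exact sub_eq_zero.1 (congrFun key j)

/-! ### Slide polynomials -/

theorem mem_compatible_snoc {m k : ℕ} {a i : Fin k → ℕ+} {p t : ℕ+} :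
    (Fin.snoc i t : Fin (k + 1) → ℕ+) ∈ compatible m (Fin.snoc a p : Fin (k + 1) → ℕ+) ↔
      i ∈ compatible m a ∧ (∀ j, i j ≤ t) ∧ (t : ℕ) ≡ p [MOD m] ∧ t ≤ p ∧
        ∀ j : Fin k, (j : ℕ) + 1 = k → a j < p → i j < t := by
  constructor
  · rintro ⟨h1, h2, h3, h4⟩
    refine ⟨⟨fun x y hxy => ?_, fun j => ?_, fun j => ?_, fun j j' hj ha => ?_⟩,
      fun j => ?_, ?_, ?_, fun j hj ha => ?_⟩
    · simpa using h1 (Fin.castSucc_le_castSucc_iff.2 hxy)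
    · simpa using h2 j.castSucc
    · simpa using h3 j.castSucc
    · simpa using h4 j.castSucc j'.castSucc (by simpa using hj) (by simpa using ha)
    · simpa using h1 (Fin.le_last j.castSucc)
    · simpa using h2 (Fin.last k)
    · simpa using h3 (Fin.last k)
    · simpa using h4 j.castSucc (Fin.last k) (by simpa using hj.symm) (by simpa using ha)
  · rintro ⟨⟨h1, h2, h3, h4⟩, h5, h6, h7, h8⟩
    refine ⟨fun x y hxy => ?_, fun j => ?_, fun j => ?_, fun j j' hj ha => ?_⟩
    · induction y using Fin.lastCases with
      | last =>
        induction x using Fin.lastCases with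
        | last => exact le_rfl
        | cast x => simpa using h5 x
      | cast y =>
        induction x using Fin.lastCases with
        | last => exact absurd hxy (not_le.2 (Fin.castSucc_lt_last y))
        | cast x => simpa using h1 (Fin.castSucc_le_castSucc_iff.1 hxy)
    · induction j using Fin.lastCases with
      | last => simpa using h6
      | cast j => simpa using h2 j
    · induction j using Fin.lastCases with
      | last => simpa using h7
      | cast j => simpa using h3 j
    · induction j using Fin.lastCases with
      | last => simp at hj; omega
      | cast j =>
        induction j' using Fin.lastCases with
        | last => simpa using h8 j (by simpa using hj.symm) (by simpa using ha)
        | cast j' => simpa using h4 j j' (by simpa using hj) (by simpa using ha)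

/-- The exponent of the monomial `∏ x_{i_j}`. -/
noncomputable def expo {k : ℕ} (i : Fin k → ℕ+) : ℕ+ →₀ ℕ := ∑ j, Finsupp.single (i j) 1

theorem prod_X_eq_monomial {k : ℕ} (i : Fin k → ℕ+) :
    (∏ j, X (i j) : Pol) = monomial (expo i) 1 := by
  rw [expo, monomial_sum_one]
  rfl

theorem mem_support_expo {k : ℕ} {i : Fin k → ℕ+} {l : ℕ+} :
    l ∈ (expo i).support ↔ ∃ j, i j = l := by
  simp [expo, Finsupp.finsetSum_apply, Finsupp.single_apply]

theorem mem_slots_expo {m k : ℕ} {i : Fin k → ℕ+} {p t : ℕ+} :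
    t ∈ slots m ((expo i).erase p) p ↔
      t ≤ p ∧ (t : ℕ) ≡ p [MOD m] ∧ ∀ j, i j ≠ p → i j < t := by
  rw [mem_slots]
  refine and_congr_right fun _ => and_congr_right fun _ => ?_
  simp only [Finsupp.support_erase, Finset.mem_erase, mem_support_expo]
  exact ⟨fun h j hj => h _ ⟨hj, j, rfl⟩, by rintro h _ ⟨hl, j, rfl⟩; exact h j hl⟩

theorem builder_prod_X (m : ℕ) {k : ℕ} (i : Fin k → ℕ+) (p : ℕ+) :
    builder m p (∏ j, X (i j)) =
      if ∀ j, i j ≤ p then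
        ∑ t ∈ slots m ((expo i).erase p) p, (∏ j, X (if i j = p then t else i j)) * X t
      else 0 := by
  rw [prod_X_eq_monomial, builder_monomial, one_smul]
  split_ifs with h
  · rw [builderMonomial_of_le, Finset.mul_sum]
    · refine Finset.sum_congr rfl fun t ht => ?_
      rw [pow_succ, ← mul_assoc]
      congr 1
      -- The substitution `x_p ↦ x_t` turns the product over positions into the fixed part `x^e`
      -- times a power of `x_t`.
      let φ : Pol →ₐ[ℤ] Pol := aeval fun l => X (if l = p then t else l)
      have hφ : ∀ l, φ (X l) = X (if l = p then t else l) := fun l => aeval_X _ l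
      have h1 : (∏ j, X (if i j = p then t else i j) : Pol) = φ (monomial (expo i) 1) := by
        rw [← prod_X_eq_monomial, map_prod]
        simp only [hφ]
      rw [h1]
      conv_rhs => rw [← Finsupp.erase_add_single p (expo i), ← mul_one (1 : ℤ), ← monomial_mul,
        ← X_pow_eq_monomial, map_mul, map_pow, hφ, if_pos rfl]
      rw [algHom_monomial_of_fixed]
      intro l hl
      rw [Finsupp.support_erase, Finset.mem_erase] at hl
      rw [hφ, if_neg hl.1]
    · intro l hl
      obtain ⟨j, rfl⟩ := mem_support_expo.1 hl
      exact h j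
  · refine if_neg fun hc => h fun j => hc _ (mem_support_expo.2 ⟨j, rfl⟩)

theorem snoc_mem_compatible {m k : ℕ} {a i : Fin k → ℕ+} {p t : ℕ+} (hi : i ∈ compatible m a)
    (hp : ∀ j, i j ≤ p) (ht : t ∈ slots m ((expo i).erase p) p) :
    (Fin.snoc (fun j => if i j = p then t else i j) t : Fin (k + 1) → ℕ+) ∈
      compatible m (Fin.snoc a p : Fin (k + 1) → ℕ+) := by
  obtain ⟨ht1, ht2, ht3⟩ := mem_slots_expo.1 ht
  obtain ⟨h1, h2, h3, h4⟩ := hi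
  have hle : ∀ j, (if i j = p then t else i j) ≤ t := fun j => by
    split_ifs with h
    exacts [le_rfl, (ht3 j h).le]
  refine mem_compatible_snoc.2 ⟨⟨fun x y hxy => ?_, fun j => ?_, fun j => ?_,
    fun j j' hj ha => ?_⟩, hle, ht2, ht1, fun j hj ha => ?_⟩
  · by_cases hy : i y = p
    · simp only [hy, if_true]
      exact hle x
    · have hx : i x ≠ p := fun hx => hy (le_antisymm (hp y) (hx ▸ h1 hxy))
      simpa only [hx, hy, if_false] using h1 hxy
  · dsimp only
    split_ifs with h
    · exact ht2.trans (h ▸ h2 j)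
    · exact h2 j
  · dsimp only
    split_ifs with h
    · exact ht1.trans (h ▸ h3 j)
    · exact h3 j
  · have hlt := h4 j j' hj ha
    have hx : i j ≠ p := (hlt.trans_le (hp j')).ne
    simp only [hx, if_false]
    split_ifs
    exacts [ht3 j hx, hlt]
  · have hx : i j ≠ p := ((h3 j).trans_lt ha).ne
    simp only [hx, if_false]
    exact ht3 j hx

/-- The entries equal to the last entry `t` form a final block. Raising them to `p` is legitimate
only if the bounds `a j` there are at least `p`; this holds because `a` followed by `p` cannot
ascend where the compatible sequence is constant. -/
theorem mem_compatible_of_snoc {m k : ℕ} {a i : Fin k → ℕ+} {p t : ℕ+}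
    (h : (Fin.snoc i t : Fin (k + 1) → ℕ+) ∈ compatible m (Fin.snoc a p : Fin (k + 1) → ℕ+)) :
    (fun j => if i j = t then p else i j) ∈ compatible m a ∧
      (∀ j, (if i j = t then p else i j) ≤ p) ∧
      t ∈ slots m ((expo fun j => if i j = t then p else i j).erase p) p := by
  obtain ⟨⟨h1, h2, h3, h4⟩, h5, h6, h7, h8⟩ := mem_compatible_snoc.1 h
  have hle : ∀ j, (if i j = t then p else i j) ≤ p := fun j => by
    split_ifs
    exacts [le_rfl, (h5 j).trans h7]
  -- Induction from the right end of the block; `n` is the distance of `j` from the last index.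
  have hpa : ∀ n (j : Fin k), (j : ℕ) + 1 + n = k → i j = t → p ≤ a j := by
    intro n
    induction n with
    | zero =>
      intro j hj hij
      by_contra! hc
      exact (h8 j hj hc).ne hij
    | succ n ih =>
      intro j hj hij
      have hj' : ((⟨j + 1, by omega⟩ : Fin k) : ℕ) = j + 1 := rfl
      generalize (⟨j + 1, by omega⟩ : Fin k) = j' at hj'
      have hjj : j ≤ j' := by rw [Fin.le_def]; omega
      have hij' : i j' = t := le_antisymm (h5 j') (hij ▸ h1 hjj)
      by_contra! hc
      exact (h4 j j' hj' (hc.trans_le (ih j' (by omega) hij'))).ne (hij.trans hij'.symm)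
  refine ⟨⟨fun x y hxy => ?_, fun j => ?_, fun j => ?_, fun j j' hj ha => ?_⟩, hle,
    mem_slots_expo.2 ⟨h7, h6, fun j hj => ?_⟩⟩
  · by_cases hy : i y = t
    · simp only [hy, if_true]
      exact hle x
    · have hx : i x ≠ t := fun hx => hy (le_antisymm (h5 y) (hx ▸ h1 hxy))
      simpa only [hx, hy, if_false] using h1 hxy
  · dsimp only
    split_ifs with h
    · exact h6.symm.trans (h ▸ h2 j)
    · exact h2 j
  · dsimp only
    split_ifs with h
    · exact hpa (k - (j + 1)) j (by omega) h
    · exact h3 j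
  · have hlt := h4 j j' hj ha
    have hx : i j ≠ t := (hlt.trans_le (h5 j')).ne
    simp only [hx, if_false]
    split_ifs
    exacts [hlt.trans_le ((h5 j').trans h7), hlt]
  · split_ifs at hj ⊢ with hjt
    · exact absurd rfl hj
    · exact lt_of_le_of_ne (h5 j) hjt

theorem builder_slide (m : ℕ) {k : ℕ} (a : Fin k → ℕ+) (p : ℕ+) :
    builder m p (slide m a) = slide m (Fin.snoc a p : Fin (k + 1) → ℕ+) := by
  classical
  simp only [slide, map_sum, builder_prod_X]
  rw [← Finset.sum_filter, Finset.sum_sigma']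
  refine Finset.sum_bij'
    (fun x _ => (Fin.snoc (fun j => if x.1 j = p then x.2 else x.1 j) x.2 : Fin (k + 1) → ℕ+))
    (fun I _ => ⟨fun j => if I j.castSucc = I (Fin.last k) then p else I j.castSucc,
      I (Fin.last k)⟩) ?_ ?_ ?_ ?_ ?_
  · rintro ⟨i, t⟩ h
    simp only [Finset.mem_sigma, Finset.mem_filter, Set.Finite.mem_toFinset] at h ⊢
    exact snoc_mem_compatible h.1.1 h.1.2 h.2
  · intro I h
    rw [Set.Finite.mem_toFinset, ← Fin.snoc_init_self I] at h
    obtain ⟨h1, h2, h3⟩ := mem_compatible_of_snoc h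
    simp only [Finset.mem_sigma, Finset.mem_filter, Set.Finite.mem_toFinset]
    exact ⟨⟨h1, h2⟩, h3⟩
  · rintro ⟨i, t⟩ h
    simp only [Finset.mem_sigma, Finset.mem_filter, Set.Finite.mem_toFinset, mem_slots_expo] at h
    obtain ⟨-, -, -, h3⟩ := h
    simp only [Fin.snoc_castSucc, Fin.snoc_last, Sigma.mk.injEq, heq_eq_eq, and_true]
    funext j
    by_cases hj : i j = p
    · simp [hj]
    · simp [hj, (h3 j hj).ne]
  · intro I h
    rw [Set.Finite.mem_toFinset, ← Fin.snoc_init_self I] at h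
    obtain ⟨-, hle, -, htp, -⟩ := mem_compatible_snoc.1 h
    funext j
    induction j using Fin.lastCases with
    | last => simp
    | cast j =>
      have h5 := hle j
      simp only [Fin.init] at h5
      simp only [Fin.snoc_castSucc]
      split_ifs with h6 h7 h7
      · exact h6.symm
      · exact absurd rfl h7
      · exact absurd (le_antisymm h5 (h7 ▸ htp)) h6
      · rfl
  · rintro ⟨i, t⟩ h
    rw [Fin.prod_univ_castSucc]
    simp

theorem slide_eq_prod (m : ℕ) {k : ℕ} (b : Fin k → ℕ+) :
    slide m b = ((List.ofFn b).reverse.map (builder m)).prod 1 := by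
  induction k with
  | zero =>
    have h : (compatible_finite m b).toFinset = Finset.univ := by
      ext i
      simp [compatible, Subsingleton.monotone]
    rw [slide, h]
    simp
  | succ k ih =>
    rw [← Fin.snoc_init_self b, ← builder_slide, ih, List.ofFn_succ_last]
    simp

theorem slide_concat (m : ℕ) (l : List ℕ+) (p : ℕ+) :
    slide m (l ++ [p]).get = builder m p (slide m l.get) := by
  rw [slide_eq_prod, slide_eq_prod, List.ofFn_get, List.ofFn_get]
  simp

theorem isHomogeneous_slide (m : ℕ) {k : ℕ} (a : Fin k → ℕ+) : (slide m a).IsHomogeneous k := by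
  refine IsHomogeneous.sum _ _ _ fun i _ => ?_
  have := IsHomogeneous.prod Finset.univ (fun j => (X (i j) : Pol)) (fun _ => 1)
    fun j _ => isHomogeneous_X ℤ (i j)
  simpa using this

end MSlides

namespace MSlides

/-! ### Grafting trees -/

namespace Tree

variable {m : ℕ}

/-- The tree with a single internal node. -/
def cherry (m : ℕ) : Tree m := .node fun _ => .leaf

theorem sum_filter_lt {N : ℕ} (f : Fin N → ℕ) (j : Fin N) :
    ∑ l ∈ Finset.univ.filter (· < j), f l =
      ∑ l ∈ Finset.range j, if h : l < N then f ⟨l, h⟩ else 0 := by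
  refine Finset.sum_bij (fun l _ => (l : ℕ)) ?_ ?_ ?_ ?_
  · intro l hl
    exact Finset.mem_range.2 (Finset.mem_filter.1 hl).2
  · intro l _ l' _ h
    exact Fin.ext h
  · intro b hb
    rw [Finset.mem_range] at hb
    exact ⟨⟨b, hb.trans j.2⟩, Finset.mem_filter.2 ⟨Finset.mem_univ _, hb⟩, rfl⟩
  · intro l _
    simp

/-- Consecutive blocks of lengths `f 0, f 1, …` tile an initial interval. This is the bookkeeping
for leaf numbers under grafting. -/
theorem sum_range_blocks (f g : ℕ → ℕ) (a : ℕ) :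
    ∑ l ∈ Finset.range a, ∑ n ∈ Finset.range (f l), g ((∑ x ∈ Finset.range l, f x) + n) =
      ∑ n ∈ Finset.range (∑ l ∈ Finset.range a, f l), g n := by
  induction a with
  | zero => simp
  | succ a ih => rw [Finset.sum_range_succ, ih, Finset.sum_range_succ, Finset.sum_range_add]

theorem sum_blocks_lt {N : ℕ} (f : Fin N → ℕ) (g : ℕ → ℕ) (j : Fin N) :
    ∑ l ∈ Finset.univ.filter (· < j),
        ∑ n ∈ Finset.range (f l), g ((∑ x ∈ Finset.univ.filter (· < l), f x) + n) =
      ∑ n ∈ Finset.range (∑ l ∈ Finset.univ.filter (· < j), f l), g n := by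
  rw [sum_filter_lt, sum_filter_lt f, ← sum_range_blocks]
  refine Finset.sum_congr rfl fun l hl => ?_
  have h : l < N := (Finset.mem_range.1 hl).trans j.2
  rw [dif_pos h, dif_pos h]
  simp only [sum_filter_lt]

theorem sum_blocks {N : ℕ} (f : Fin N → ℕ) (g : ℕ → ℕ) :
    ∑ l, ∑ n ∈ Finset.range (f l), g ((∑ x ∈ Finset.univ.filter (· < l), f x) + n) =
      ∑ n ∈ Finset.range (∑ l, f l), g n := by
  rw [Finset.sum_fin_eq_sum_range, Finset.sum_fin_eq_sum_range f, ← sum_range_blocks]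
  refine Finset.sum_congr rfl fun l hl => ?_
  have h : l < N := Finset.mem_range.1 hl
  rw [dif_pos h, dif_pos h]
  simp only [sum_filter_lt]

theorem leaves_graft (t : Tree m) (G : ℕ → Tree m) :
    (t.graft G).leaves = ∑ n ∈ Finset.range t.leaves, (G n).leaves := by
  induction t generalizing G with
  | leaf => simp [graft, leaves]
  | node c ih =>
    simp only [graft, leaves, ih]
    exact sum_blocks (fun j => (c j).leaves) fun n => (G n).leaves

theorem graft_graft (t : Tree m) (G H : ℕ → Tree m) :
    (t.graft G).graft H =
      t.graft fun n => (G n).graft fun q => H ((∑ x ∈ Finset.range n, (G x).leaves) + q) := by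
  induction t generalizing G H with
  | leaf => simp [graft]
  | node c ih =>
    simp only [graft, ih, leaves_graft]
    congr 1
    funext j
    congr 1
    funext n
    congr 1
    funext q
    rw [sum_blocks_lt (fun j => (c j).leaves) (fun n => (G n).leaves), Finset.sum_range_add,
      add_assoc]

theorem graft_leaf (t : Tree m) : (t.graft fun _ => .leaf) = t := by
  induction t with
  | leaf => rfl
  | node c ih => simp only [graft, ih]

theorem cherry_graft (G : ℕ → Tree m) : (cherry m).graft G = .node fun j => G j := by
  simp only [cherry, graft, leaves]
  congr 1
  funext j
  congr 1
  simp only [Finset.sum_const, smul_eq_mul, mul_one, add_zero]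
  rw [Finset.filter_gt_eq_Iio, Fin.card_Iio]

theorem graft_eq_leaf {t : Tree m} {G : ℕ → Tree m} (h : t.graft G = .leaf) :
    t = .leaf ∧ G 0 = .leaf := by
  cases t with
  | leaf => exact ⟨rfl, h⟩
  | node c => exact absurd h (by simp [graft])

/-- Each grafted piece has height at most one. A leaf and a node could then have the same graft only
if that graft were a cherry, and the piece on leaf number `0` tells the two cases apart. -/
theorem graft_injective {t t' : Tree m} {K : ℕ → Tree m}
    (hK : ∀ n, K n = .leaf ∨ K n = cherry m) (h : t.graft K = t'.graft K) : t = t' := by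
  have leaf_node : ∀ (c : Fin (m + 1) → Tree m) (K : ℕ → Tree m),
      (∀ n, K n = .leaf ∨ K n = cherry m) → (leaf : Tree m).graft K ≠ (node c).graft K := by
    intro c K hK h
    simp only [graft] at h
    rcases hK 0 with h0 | h0
    · rw [h0] at h
      exact absurd h (by simp)
    · have h1 := h
      rw [h0, cherry, node.injEq] at h1
      have h2 := (graft_eq_leaf (congrFun h1 0).symm).2
      simp [cherry, h0] at h2
  induction t generalizing t' K with
  | leaf =>
    cases t' with
    | leaf => rfl
    | node c => exact absurd h (leaf_node c K hK)
  | node c ih =>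
    cases t' with
    | leaf => exact absurd h.symm (leaf_node c K hK)
    | node c' =>
      simp only [graft, node.injEq] at h
      congr 1
      funext j
      -- The children are compared from left to right: the pieces grafted onto child `j` depend on
      -- the number of leaves to its left, which agrees once the earlier children agree.
      induction hn : (j : ℕ) using Nat.strong_induction_on generalizing j with
      | _ n ihn =>
        subst hn
        have hs : ∑ l ∈ Finset.univ.filter (· < j), (c l).leaves =
            ∑ l ∈ Finset.univ.filter (· < j), (c' l).leaves :=
          Finset.sum_congr rfl fun l hl => by rw [ihn l (Finset.mem_filter.1 hl).2 l rfl]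
        have hj := congrFun h j
        rw [hs] at hj
        exact ih j (fun n => hK _) hj

end Tree
-- The monoid of indexed forests
namespace Forest

variable {m : ℕ}

/-- The tree of `F` with index `a`, counted from zero. -/
def treeAt (F : Forest m) (a : ℕ) : Tree m := F.tree (Nat.succPNat a)

/-- The number of leaves of the first `a` trees of `F`. -/
def leavesBefore (F : Forest m) (a : ℕ) : ℕ := ∑ n ∈ Finset.range a, (F.treeAt n).leaves

theorem ext_treeAt {F G : Forest m} (h : ∀ a, F.treeAt a = G.treeAt a) : F = G := by
  ext1
  funext i
  rw [← PNat.succPNat_natPred i]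
  exact h _

theorem offset_succPNat (F : Forest m) (a : ℕ) : F.offset (Nat.succPNat a) = F.leavesBefore a := by
  rw [offset, leavesBefore]
  refine (Finset.sum_bij (fun n _ => Nat.succPNat n) ?_ ?_ ?_ ?_).symm
  · intro n hn
    simpa [← PNat.coe_lt_coe] using hn
  · intro n _ n' _ h
    exact Nat.succPNat_injective h
  · intro b hb
    refine ⟨b.natPred, ?_, PNat.succPNat_natPred b⟩
    have := b.pos
    simp only [Finset.mem_Ico, ← PNat.coe_lt_coe, Nat.succPNat_coe] at hb
    simp only [Finset.mem_range, PNat.natPred]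
    omega
  · intro n _
    rfl

theorem leavesBefore_add (F : Forest m) (a b : ℕ) :
    F.leavesBefore (a + b) =
      F.leavesBefore a + ∑ x ∈ Finset.range b, (F.treeAt (a + x)).leaves := by
  rw [leavesBefore, Finset.sum_range_add, ← leavesBefore]

theorem leavesBefore_succ (F : Forest m) (a : ℕ) :
    F.leavesBefore (a + 1) = F.leavesBefore a + (F.treeAt a).leaves := by
  rw [leavesBefore_add]
  simp

theorem treeAt_mul (F G : Forest m) (a : ℕ) :
    (F * G).treeAt a = (F.treeAt a).graft fun n => G.treeAt (F.leavesBefore a + n) := by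
  rw [← offset_succPNat]
  rfl

theorem leavesBefore_mul (F G : Forest m) (a : ℕ) :
    (F * G).leavesBefore a = G.leavesBefore (F.leavesBefore a) := by
  induction a with
  | zero => simp [leavesBefore]
  | succ a ih =>
    rw [leavesBefore_succ, ih, treeAt_mul, Tree.leaves_graft, leavesBefore_succ, leavesBefore_add]

theorem treeAt_one (a : ℕ) : (1 : Forest m).treeAt a = .leaf := rfl

theorem leavesBefore_one (a : ℕ) : (1 : Forest m).leavesBefore a = a := by
  simp [leavesBefore, treeAt_one, Tree.leaves]

instance : Monoid (Forest m) where
  mul_assoc F G H := ext_treeAt fun a => by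
    simp only [treeAt_mul, Tree.graft_graft, leavesBefore_mul]
    congr 1
    funext n
    congr 1
    funext q
    rw [leavesBefore_add, add_assoc]
  one_mul F := ext_treeAt fun a => by
    rw [treeAt_mul, treeAt_one, leavesBefore_one]
    rfl
  mul_one F := ext_treeAt fun a => by
    rw [treeAt_mul]
    exact Tree.graft_leaf _

theorem treeAt_single (b a : ℕ) :
    (single m (Nat.succPNat b)).treeAt a = if a = b then Tree.cherry m else .leaf := by
  simp only [treeAt, single, Nat.succPNat_inj]
  rfl

theorem leavesBefore_single (b a : ℕ) :
    (single m (Nat.succPNat b)).leavesBefore a = if a ≤ b then a else a + m := by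
  induction a with
  | zero => simp [leavesBefore]
  | succ a ih =>
    rw [leavesBefore_succ, ih, treeAt_single]
    have h : (Tree.cherry m).leaves = m + 1 := by simp [Tree.cherry, Tree.leaves]
    have h' : (Tree.leaf : Tree m).leaves = 1 := rfl
    rcases lt_trichotomy a b with hab | rfl | hab
    · rw [if_pos hab.le, if_neg hab.ne, if_pos (by omega), h']
    · rw [if_pos le_rfl, if_pos rfl, if_neg (by omega), h]
      omega
    · rw [if_neg (by omega), if_neg hab.ne', if_neg (by omega), h']
      omega

theorem treeAt_single_mul (b : ℕ) (F : Forest m) (a : ℕ) :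
    (single m (Nat.succPNat b) * F).treeAt a =
      if a < b then F.treeAt a else if a = b then .node fun j => F.treeAt (b + j)
        else F.treeAt (a + m) := by
  rw [treeAt_mul, treeAt_single, leavesBefore_single]
  rcases lt_trichotomy a b with hab | rfl | hab
  · rw [if_neg hab.ne, if_pos hab.le, if_pos hab]
    rfl
  · rw [if_pos rfl, if_pos le_rfl, if_neg (lt_irrefl _), if_pos rfl, Tree.cherry_graft]
  · rw [if_neg hab.ne', if_neg hab.not_ge, if_neg hab.not_gt, if_neg hab.ne']
    rfl

theorem single_mul_single {i j k : ℕ+} (h : j < i) (hk : (k : ℕ) = i + m) :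
    single m i * single m j = single m j * single m k := by
  obtain ⟨i, rfl⟩ : ∃ a, i = Nat.succPNat a := ⟨_, (PNat.succPNat_natPred i).symm⟩
  obtain ⟨j, rfl⟩ : ∃ a, j = Nat.succPNat a := ⟨_, (PNat.succPNat_natPred j).symm⟩
  obtain ⟨k, rfl⟩ : ∃ a, k = Nat.succPNat a := ⟨_, (PNat.succPNat_natPred k).symm⟩
  have h' : j < i := Nat.succPNat_lt_succPNat.1 h
  have hk' : k = i + m := by
    simp only [Nat.succPNat_coe] at hk
    omega
  subst hk'
  refine ext_treeAt fun a => ?_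
  simp only [treeAt_single_mul, treeAt_single]
  rcases lt_trichotomy a i with hai | rfl | hai
  · rw [if_pos hai]
    rcases lt_trichotomy a j with haj | rfl | haj
    · rw [if_neg haj.ne, if_pos haj, if_neg (by omega)]
    · rw [if_pos rfl, if_neg (lt_irrefl _), if_pos rfl, Tree.cherry]
      congr 1
      funext l
      rw [if_neg (by omega)]
    · rw [if_neg haj.ne', if_neg haj.not_gt, if_neg haj.ne', if_neg (by omega)]
  · rw [if_neg (lt_irrefl _), if_pos rfl, if_neg h'.not_gt, if_neg h'.ne', if_pos rfl, Tree.cherry]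
    congr 1
    funext l
    rw [if_neg (by omega)]
  · rw [if_neg hai.not_gt, if_neg hai.ne', if_neg (by omega), if_neg (by omega), if_neg (by omega),
      if_neg (by omega)]

theorem mul_single_injective {G G' : Forest m} {i : ℕ+} (h : G * single m i = G' * single m i) :
    G = G' := by
  obtain ⟨i, rfl⟩ : ∃ a, i = Nat.succPNat a := ⟨_, (PNat.succPNat_natPred i).symm⟩
  refine ext_treeAt fun a => ?_
  induction a using Nat.strong_induction_on with
  | _ a ih =>
    have hl : G.leavesBefore a = G'.leavesBefore a :=
      Finset.sum_congr rfl fun n hn => by rw [ih n (Finset.mem_range.1 hn)]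
    have ha := congrArg (fun F => F.treeAt a) h
    simp only [treeAt_mul, hl, treeAt_single] at ha
    refine Tree.graft_injective (fun n => ?_) ha
    split_ifs
    exacts [Or.inr rfl, Or.inl rfl]

theorem exists_treeAt_eq_leaf (F : Forest m) : ∃ N, ∀ a, N ≤ a → F.treeAt a = .leaf := by
  obtain ⟨N, hN⟩ := F.finite.bddAbove
  refine ⟨N, fun a ha => ?_⟩
  by_contra hc
  have h : Nat.succPNat a ≤ N := hN hc
  rw [← PNat.coe_le_coe, Nat.succPNat_coe] at h
  omega

theorem exists_eq_single_mul {F : Forest m} (hF : F ≠ 1) : ∃ i G, F = single m i * G := by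
  obtain ⟨b, hb⟩ : ∃ b, F.treeAt b ≠ .leaf := by
    by_contra! hc
    exact hF (ext_treeAt hc)
  obtain ⟨N, hN⟩ := F.exists_treeAt_eq_leaf
  cases hc : F.treeAt b with
  | leaf => exact absurd hc hb
  | node c =>
    -- Removing the root of tree `b` puts its `m + 1` children at positions `b, …, b + m` and shifts
    -- all later trees by `m`.
    let t : ℕ → Tree m := fun a =>
      if a < b then F.treeAt a else if h : a - b < m + 1 then c ⟨a - b, h⟩ else F.treeAt (a - m)
    have ht : ∀ a, N + b + m < a → t a = .leaf := fun a ha => by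
      simp only [t]
      rw [if_neg (by omega), dif_neg (by omega), hN _ (by omega)]
    refine ⟨Nat.succPNat b, ⟨fun q => t q.natPred, ?_⟩, ext_treeAt fun a => ?_⟩
    · refine (Set.finite_Iic (Nat.succPNat (N + b + m))).subset fun q hq => ?_
      by_contra hlt
      refine hq (ht _ ?_)
      rw [Set.mem_Iic, not_le, ← PNat.coe_lt_coe, Nat.succPNat_coe] at hlt
      rw [PNat.natPred]
      omega
    · rw [treeAt_single_mul]
      simp only [treeAt, Nat.natPred_succPNat] at hc ⊢
      rcases lt_trichotomy a b with hab | rfl | hab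
      · simp only [t, if_pos hab]
        rfl
      · rw [if_neg (lt_irrefl _), if_pos rfl, hc]
        congr 1
        funext j
        simp only [t]
        rw [if_neg (by omega), dif_pos (by omega)]
        congr 1
        ext
        simp
      · rw [if_neg hab.not_gt, if_neg hab.ne']
        simp only [t]
        rw [if_neg (by omega), dif_neg (by omega), Nat.add_sub_cancel]
        rfl

/-- The forest `F` has `e` more leaves than the empty forest. -/
def HasExcess (F : Forest m) (e : ℕ) : Prop := ∃ N, ∀ a, N ≤ a → F.leavesBefore a = a + e

theorem HasExcess.unique {F : Forest m} {e e' : ℕ} (h : F.HasExcess e) (h' : F.HasExcess e') :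
    e = e' := by
  obtain ⟨N, hN⟩ := h
  obtain ⟨N', hN'⟩ := h'
  have := hN (max N N') (le_max_left _ _)
  have := hN' (max N N') (le_max_right _ _)
  omega

theorem hasExcess_one : (1 : Forest m).HasExcess 0 := ⟨0, fun a _ => leavesBefore_one a⟩

theorem hasExcess_single (i : ℕ+) : (single m i).HasExcess m := by
  rw [← PNat.succPNat_natPred i]
  refine ⟨i.natPred + 1, fun a ha => ?_⟩
  rw [leavesBefore_single, if_neg (by omega)]

theorem HasExcess.mul {F G : Forest m} {e e' : ℕ} (h : F.HasExcess e) (h' : G.HasExcess e') :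
    (F * G).HasExcess (e + e') := by
  obtain ⟨N, hN⟩ := h
  obtain ⟨N', hN'⟩ := h'
  refine ⟨max N N', fun a ha => ?_⟩
  rw [max_le_iff] at ha
  rw [leavesBefore_mul, hN a ha.1, hN' _ (by omega), add_assoc]

theorem le_leavesBefore (F : Forest m) (a : ℕ) : a ≤ F.leavesBefore a := by
  have := F.le_offset (Nat.succPNat a)
  rw [offset_succPNat, Nat.succPNat_coe] at this
  omega

theorem leavesBefore_add_of_leaf {F : Forest m} {N : ℕ} (h : ∀ a, N ≤ a → F.treeAt a = .leaf)
    (d : ℕ) : F.leavesBefore (N + d) = F.leavesBefore N + d := by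
  rw [leavesBefore_add]
  congr 1
  rw [Finset.sum_congr rfl fun x _ => congrArg Tree.leaves (h (N + x) (Nat.le_add_right _ _))]
  simp [Tree.leaves]

theorem exists_hasExcess (F : Forest m) : ∃ e, F.HasExcess e := by
  obtain ⟨N, hN⟩ := F.exists_treeAt_eq_leaf
  refine ⟨F.leavesBefore N - N, N, fun a ha => ?_⟩
  obtain ⟨d, rfl⟩ := Nat.exists_eq_add_of_le ha
  have := F.le_leavesBefore N
  rw [leavesBefore_add_of_leaf hN]
  omega

/-- The product `i̲₁ · i̲₂ ⋯ i̲_k`. -/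
def ofWord (m : ℕ) (l : List ℕ+) : Forest m := (l.map (single m)).prod

theorem ofWord_concat (l : List ℕ+) (i : ℕ+) :
    ofWord m (l ++ [i]) = ofWord m l * single m i := by
  simp [ofWord]

theorem mem_trim {F : Forest m} {l : List ℕ+} : l ∈ F.trim ↔ ofWord m l = F := by
  rw [ofWord, List.prod_eq_foldl, List.foldl_map]
  rfl

theorem hasExcess_ofWord (l : List ℕ+) : (ofWord m l).HasExcess (l.length * m) := by
  induction l with
  | nil =>
    rw [List.length_nil, Nat.zero_mul]
    exact hasExcess_one
  | cons i l ih =>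
    rw [ofWord, List.map_cons, List.prod_cons, List.length_cons, Nat.succ_mul, add_comm]
    exact (hasExcess_single i).mul ih

/-- The excess is additive and each generator contributes `m`. Since `m ≥ 1`, it counts the factors.
-/
theorem length_eq_of_ofWord_eq (hm : 1 ≤ m) {l l' : List ℕ+} (h : ofWord m l = ofWord m l') :
    l.length = l'.length :=
  Nat.eq_of_mul_eq_mul_right hm ((hasExcess_ofWord l).unique (h ▸ hasExcess_ofWord l'))

theorem exists_ofWord_eq (hm : 1 ≤ m) (F : Forest m) : ∃ l, ofWord m l = F := by
  obtain ⟨e, he⟩ := F.exists_hasExcess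
  -- Splitting off a root node on the left lowers the excess by `m ≥ 1`.
  induction e using Nat.strong_induction_on generalizing F with
  | _ e ih =>
    by_cases hF : F = 1
    · exact ⟨[], hF.symm⟩
    · obtain ⟨i, G, rfl⟩ := exists_eq_single_mul hF
      obtain ⟨e', he'⟩ := G.exists_hasExcess
      have := he.unique ((hasExcess_single i).mul he')
      obtain ⟨l, rfl⟩ := ih e' (by omega) G he'
      exact ⟨i :: l, by simp [ofWord]⟩

theorem finite_right_divisors (F : Forest m) : {i | ∃ G, G * single m i = F}.Finite := by
  obtain ⟨N, hN⟩ := F.exists_treeAt_eq_leaf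
  refine (Set.finite_Iic (Nat.succPNat (F.leavesBefore N))).subset ?_
  rintro i ⟨G, rfl⟩
  obtain ⟨b, rfl⟩ : ∃ a, i = Nat.succPNat a := ⟨_, (PNat.succPNat_natPred i).symm⟩
  rw [Set.mem_Iic, Nat.succPNat_le_succPNat, leavesBefore_mul]
  -- A node attached at a leaf `b` this far right would sit on one of the trivial trees of `G` with
  -- index at least `N`, making a tree of the product nontrivial there.
  by_contra! hlt
  have hG : G.leavesBefore N ≤ b := ((le_leavesBefore _ _).trans_lt hlt).le
  simp only [treeAt_mul] at hN
  obtain ⟨d, rfl⟩ := Nat.exists_eq_add_of_le hG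
  have h1 := (Tree.graft_eq_leaf (hN (N + d) (Nat.le_add_right _ _))).2
  rw [leavesBefore_add_of_leaf fun a ha => (Tree.graft_eq_leaf (hN a ha)).1, treeAt_single,
    if_pos (add_zero _)] at h1
  simp [Tree.cherry] at h1

end Forest

end MSlides

namespace MSlides

open MvPolynomial Forest

variable {m : ℕ}

/-! ### Forest polynomials -/

namespace Forest

theorem mul_single_ne_one (hm : 1 ≤ m) (G : Forest m) (i : ℕ+) : G * single m i ≠ 1 := by
  intro h
  obtain ⟨l, rfl⟩ := exists_ofWord_eq hm G
  rw [← ofWord_concat] at h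
  have := length_eq_of_ofWord_eq (l' := []) hm h
  simp at this

theorem length_add_one_of_ofWord_mul_single (hm : 1 ≤ m) {l l' : List ℕ+} {i : ℕ+}
    (h : ofWord m l' * single m i = ofWord m l) : l'.length + 1 = l.length := by
  rw [← ofWord_concat] at h
  simpa using length_eq_of_ofWord_eq hm h

/-- Trimming sequences are sorted by their last letter `i`. Only finitely many letters occur, and by
right cancellation the remaining prefixes all trim the same smaller forest. -/
theorem finite_trim_ofWord (hm : 1 ≤ m) (n : ℕ) :
    ∀ l : List ℕ+, l.length = n → (ofWord m l).trim.Finite := by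
  induction n with
  | zero =>
    intro l hl
    refine (Set.finite_singleton []).subset fun l' hl' => ?_
    rw [Set.mem_singleton_iff, ← List.length_eq_zero_iff, ← hl]
    exact length_eq_of_ofWord_eq hm (mem_trim.1 hl')
  | succ n ih =>
    intro l hl
    have hfin : (⋃ i ∈ {i | ∃ G, G * single m i = ofWord m l},
        (fun l' => l' ++ [i]) '' {l' | ofWord m l' * single m i = ofWord m l}).Finite := by
      refine (finite_right_divisors _).biUnion fun i _ => Set.Finite.image _ ?_
      rcases Set.eq_empty_or_nonempty {l' | ofWord m l' * single m i = ofWord m l} with h | ⟨l₀, h₀⟩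
      · rw [h]
        exact Set.finite_empty
      · have h₀' : ofWord m l₀ * single m i = ofWord m l := h₀
        have hlen : l₀.length = n := by
          have := length_add_one_of_ofWord_mul_single hm h₀'
          omega
        refine (ih l₀ hlen).subset fun l' hl' => mem_trim.2 ?_
        have hl'' : ofWord m l' * single m i = ofWord m l := hl'
        exact mul_single_injective (hl''.trans h₀'.symm)
    refine hfin.subset fun l' hl' => ?_
    rw [mem_trim] at hl'
    rcases List.eq_nil_or_concat' l' with rfl | ⟨l₁, i, rfl⟩
    · have := length_eq_of_ofWord_eq hm hl'
      rw [List.length_nil] at this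
      omega
    · rw [ofWord_concat] at hl'
      exact Set.mem_biUnion (show i ∈ {i | ∃ G, G * single m i = ofWord m l} from ⟨_, hl'⟩)
        ⟨l₁, hl', rfl⟩

theorem finite_trim (hm : 1 ≤ m) (F : Forest m) : F.trim.Finite := by
  obtain ⟨l, rfl⟩ := exists_ofWord_eq hm F
  exact finite_trim_ofWord hm _ l rfl

end Forest

/-- The sum of the slide polynomials over the trimming sequences of `F / x`. -/
noncomputable def quotPoly (x F : Forest m) : Pol :=
  ∑ᶠ l ∈ {l | ofWord m l * x = F}, slide m l.get

/-- The `m`-forest polynomial of `F`. -/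
noncomputable def forestPoly (F : Forest m) : Pol := ∑ᶠ l ∈ F.trim, slide m l.get

theorem quotPoly_one (F : Forest m) : quotPoly 1 F = forestPoly F := by
  rw [quotPoly, forestPoly]
  congr 1
  funext l
  rw [Set.mem_ofPred_eq, mem_trim, mul_one]

theorem quotPoly_mul_single (x H : Forest m) (j : ℕ+) :
    quotPoly (x * single m j) (H * single m j) = quotPoly x H := by
  have : {l | ofWord m l * (x * single m j) = H * single m j} = {l | ofWord m l * x = H} := by
    ext l
    simp only [Set.mem_ofPred_eq, ← mul_assoc]
    exact ⟨mul_single_injective, fun h => by rw [h]⟩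
  rw [quotPoly, this, quotPoly]

theorem quotPoly_single (H : Forest m) (j : ℕ+) :
    quotPoly (single m j) (H * single m j) = forestPoly H := by
  rw [← quotPoly_one, ← quotPoly_mul_single 1 H j, one_mul]

theorem quotPoly_eq_zero {x F : Forest m} (h : ∀ G, G * x ≠ F) : quotPoly x F = 0 := by
  rw [quotPoly]
  refine finsum_mem_eq_zero_of_forall_eq_zero fun l hl => absurd hl (h _)

theorem quotPoly_mul_eq_zero {x F : Forest m} {j : ℕ+} (h : ∀ G, G * single m j ≠ F) :
    quotPoly (x * single m j) F = 0 :=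
  quotPoly_eq_zero fun G => by
    rw [← mul_assoc]
    exact h _

theorem finite_support_quotPoly (F : Forest m) :
    (Function.support fun i => quotPoly (single m i) F).Finite := by
  refine (finite_right_divisors F).subset fun i hi => ?_
  by_contra hc
  exact hi (quotPoly_eq_zero fun G hG => hc ⟨G, hG⟩)

theorem forestPoly_one (hm : 1 ≤ m) : forestPoly (1 : Forest m) = 1 := by
  have h : (1 : Forest m).trim = {[]} := by
    ext l
    rw [mem_trim, Set.mem_singleton_iff]
    refine ⟨fun h => ?_, fun h => h ▸ rfl⟩
    exact List.length_eq_zero_iff.1 (length_eq_of_ofWord_eq (l' := []) hm h)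
  rw [forestPoly, h, finsum_mem_singleton, slide_eq_prod]
  simp

/-- A nonempty forest has no empty trimming sequence, so its sequences split disjointly by last
letter `i`, and `B_i` appends that letter to each slide. -/
theorem forestPoly_eq_finsum_builder (hm : 1 ≤ m) {F : Forest m} (hF : F ≠ 1) :
    forestPoly F = ∑ᶠ i, builder m i (quotPoly (single m i) F) := by
  set I := {i | ∃ G, G * single m i = F}
  have hsub : ∀ i, {l | ofWord m l * single m i = F} = (fun l => l ++ [i]) ⁻¹' F.trim := by
    intro i
    ext l
    rw [Set.mem_preimage, mem_trim, ofWord_concat, Set.mem_ofPred_eq]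
  have hinj : ∀ i : ℕ+, Function.Injective fun l : List ℕ+ => l ++ [i] :=
    fun i l l' h => List.append_cancel_right h
  have hfin : ∀ i, {l | ofWord m l * single m i = F}.Finite := fun i => by
    rw [hsub]
    exact (finite_trim hm F).preimage (hinj i).injOn
  have htrim : F.trim = ⋃ i ∈ I, (fun l => l ++ [i]) '' {l | ofWord m l * single m i = F} := by
    ext l
    simp only [Set.mem_iUnion, Set.mem_image, exists_prop, Set.mem_ofPred_eq]
    constructor
    · intro hl
      rw [mem_trim] at hl
      rcases List.eq_nil_or_concat' l with rfl | ⟨l₁, i, rfl⟩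
      · exact absurd hl.symm hF
      · rw [ofWord_concat] at hl
        exact ⟨i, ⟨_, hl⟩, l₁, hl, rfl⟩
    · rintro ⟨i, -, l₁, hl, rfl⟩
      rw [mem_trim, ofWord_concat, hl]
  have hdisj : I.PairwiseDisjoint
      fun i => (fun l => l ++ [i]) '' {l | ofWord m l * single m i = F} := by
    intro i _ j _ hij
    refine Set.disjoint_left.2 ?_
    rintro _ ⟨l, -, rfl⟩ ⟨l', -, h⟩
    have := (List.append_inj' h rfl).2
    simp only [List.cons.injEq, and_true] at this
    exact hij this.symm
  rw [forestPoly, htrim, finsum_mem_biUnion hdisj (finite_right_divisors F)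
    fun i _ => (hfin i).image _]
  have hterm : ∀ i, ∑ᶠ l ∈ (fun l => l ++ [i]) '' {l | ofWord m l * single m i = F},
      slide m l.get = builder m i (quotPoly (single m i) F) := by
    intro i
    rw [finsum_mem_image (hinj i).injOn, quotPoly]
    simp only [slide_concat]
    exact ((builder m i).toAddMonoidHom.map_finsum_mem _ (hfin i)).symm
  simp only [hterm]
  refine finsum_congr fun i => ?_
  by_cases hi : i ∈ I
  · simp only [hi, finsum_true]
  · rw [quotPoly_eq_zero fun G hG => hi ⟨G, hG⟩, map_zero]
    simp

/-- Induction on the number of nodes. For the smaller forests `F/j` the claim identifies `T_i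
P_{F/j}` with the polynomial of `F` divided on the right by `i̲ · j̲`. The relation `i̲ · j̲ = j̲ ·
k̲` for `j < i`, `k = i + m` is then exactly the compatibility that `tope_finsum_builder` requires.
-/
theorem tope_forestPoly_ofWord (hm : 1 ≤ m) (n : ℕ) :
    ∀ l : List ℕ+, l.length = n → ∀ j,
      tope m j (forestPoly (ofWord m l)) = quotPoly (single m j) (ofWord m l) := by
  induction n with
  | zero =>
    intro l hl j
    obtain rfl := List.length_eq_zero_iff.1 hl
    have h : ofWord m [] = 1 := rfl
    rw [h, forestPoly_one hm, ← C_1, tope_C,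
      quotPoly_eq_zero fun G => mul_single_ne_one hm G j]
  | succ n ih =>
    intro l hl j
    have key : ∀ i j, tope m i (quotPoly (single m j) (ofWord m l)) =
        quotPoly (single m i * single m j) (ofWord m l) := by
      intro i j
      by_cases h : ∃ G, G * single m j = ofWord m l
      · obtain ⟨G, hG⟩ := h
        obtain ⟨l', rfl⟩ := exists_ofWord_eq hm G
        have hlen : l'.length = n := by
          have := length_add_one_of_ofWord_mul_single hm hG
          omega
        rw [← hG, quotPoly_single, quotPoly_mul_single, ih l' hlen]
      · push Not at h
        rw [quotPoly_eq_zero h, quotPoly_mul_eq_zero h, map_zero]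
    have hne : ofWord m l ≠ 1 := fun h => by
      have := length_eq_of_ofWord_eq (l' := []) hm h
      rw [List.length_nil] at this
      omega
    rw [forestPoly_eq_finsum_builder hm hne]
    refine tope_finsum_builder m hm (finite_support_quotPoly _) (fun i j k hij hk => ?_) j
    rw [key, key, single_mul_single hij hk]

theorem tope_forestPoly (hm : 1 ≤ m) (F : Forest m) (j : ℕ+) :
    tope m j (forestPoly F) = quotPoly (single m j) F := by
  obtain ⟨l, rfl⟩ := exists_ofWord_eq hm F
  exact tope_forestPoly_ofWord hm _ l rfl j

theorem isHomogeneous_forestPoly (hm : 1 ≤ m) (l : List ℕ+) :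
    (forestPoly (ofWord m l)).IsHomogeneous l.length := by
  rw [forestPoly, finsum_mem_eq_finite_toFinset_sum _ (finite_trim hm _)]
  refine IsHomogeneous.sum _ _ _ fun l' hl' => ?_
  rw [Set.Finite.mem_toFinset, mem_trim] at hl'
  rw [← length_eq_of_ofWord_eq hm hl']
  exact isHomogeneous_slide m _

theorem isForestFamily_forestPoly (hm : 1 ≤ m) : IsForestFamily m forestPoly where
  homogeneous F := by
    obtain ⟨l, rfl⟩ := exists_ofWord_eq hm F
    exact ⟨_, isHomogeneous_forestPoly hm l⟩
  empty := forestPoly_one hm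
  trim G i := by rw [tope_forestPoly hm, quotPoly_single]
  zero F i h := by
    rw [tope_forestPoly hm, quotPoly_eq_zero fun G hG => h ⟨G, hG.symm⟩]

/-! ### Uniqueness of the forest family -/

namespace IsForestFamily

variable {P Q : Forest m → Pol}

theorem ne_zero (hP : IsForestFamily m P) (l : List ℕ+) : P (ofWord m l) ≠ 0 := by
  induction l using List.reverseRecOn with
  | nil =>
    have h : ofWord m [] = 1 := rfl
    rw [h, hP.empty]
    exact one_ne_zero
  | append_singleton l i ih =>
    intro h
    rw [ofWord_concat] at h
    exact ih (by rw [← hP.trim _ i, h, map_zero])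

theorem constantCoeff_eq_zero (hP : IsForestFamily m P) (l : List ℕ+) (i : ℕ+) :
    constantCoeff (P (ofWord m l * single m i)) = 0 := by
  obtain ⟨d, hd⟩ := hP.homogeneous (ofWord m l * single m i)
  rcases Nat.eq_zero_or_pos d with rfl | hpos
  -- A homogeneous polynomial of degree zero is constant, hence killed by `T_i`, whereas here `T_i`
  -- must return the nonzero polynomial of the trimmed forest.
  · exfalso
    have hC := totalDegree_eq_zero_iff_eq_C.1 (Nat.le_zero.1 hd.totalDegree_le)
    apply hP.ne_zero l
    rw [← hP.trim _ i, hC, tope_C]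
  · exact hd.coeff_eq_zero (by simpa using hpos.ne)

/-- By induction on the number of nodes, all images under the `T_j` agree. The creation identity
rebuilds both polynomials from these images, because neither has a constant term. -/
theorem eq (hm : 1 ≤ m) (hP : IsForestFamily m P) (hQ : IsForestFamily m Q) : P = Q := by
  have key : ∀ n, ∀ l : List ℕ+, l.length = n → P (ofWord m l) = Q (ofWord m l) := by
    intro n
    induction n with
    | zero =>
      intro l hl
      obtain rfl := List.length_eq_zero_iff.1 hl
      exact hP.empty.trans hQ.empty.symm
    | succ n ih =>
      intro l hl
      have htope : ∀ j, tope m j (P (ofWord m l)) = tope m j (Q (ofWord m l)) := by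
        intro j
        by_cases h : ∃ G, ofWord m l = G * single m j
        · obtain ⟨G, hG⟩ := h
          obtain ⟨l', rfl⟩ := exists_ofWord_eq hm G
          have hlen : l'.length = n := by
            have := length_add_one_of_ofWord_mul_single hm hG.symm
            omega
          rw [hG, hP.trim, hQ.trim, ih l' hlen]
        · rw [hP.zero _ j h, hQ.zero _ j h]
      rcases List.eq_nil_or_concat' l with rfl | ⟨l₁, i, rfl⟩
      · simp at hl
      · have h := (isCreationFor_tope m hm).2
        have hP0 := hP.constantCoeff_eq_zero l₁ i
        have hQ0 := hQ.constantCoeff_eq_zero l₁ i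
        rw [← ofWord_concat] at hP0 hQ0
        rw [← (h _ hP0).2, ← (h _ hQ0).2]
        simp only [htope]
  funext F
  obtain ⟨l, rfl⟩ := exists_ofWord_eq hm F
  exact key _ l rfl

end IsForestFamily

end MSlides

open MSlides
theorem mainTheorem12 (m : ℕ) (hm : 1 ≤ m) :
    (∀ (k : ℕ) (a : Fin k → ℕ+) (p : ℕ+),
      builder m p (slide m a) = slide m (Fin.snoc a p : Fin (k + 1) → ℕ+)) ∧
    (∀ (k : ℕ) (b : Fin k → ℕ+),
      slide m b = ((List.ofFn b).reverse.map (builder m)).prod 1) ∧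
    IsCreationFor (builder m) (dope m) ∧
    IsCreationFor (builder m) (tope m) ∧
    (∃! P : Forest m → Pol, IsForestFamily m P) ∧
    ∀ P : Forest m → Pol, IsForestFamily m P → ∀ F : Forest m,
      F.trim.Finite ∧ P F = ∑ᶠ l ∈ F.trim, slide m l.get :=
  ⟨fun _ a p => builder_slide m a p, fun _ b => slide_eq_prod m b, isCreationFor_dope m hm,
    isCreationFor_tope m hm,
    ⟨forestPoly, isForestFamily_forestPoly hm, fun _ hP =>
      IsForestFamily.eq hm hP (isForestFamily_forestPoly hm)⟩,
    fun _ hP F => ⟨Forest.finite_trim hm F,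
      congrFun (IsForestFamily.eq hm hP (isForestFamily_forestPoly hm)) F⟩⟩
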